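/- Let $p$ be a prime, $t\ge 1$ an integer, and let $b_1,\ldots,b_t\in\mathbb F_p[X]$ be monic, nonconstant and pairwise coprime; put $e_j=\deg b_j$. Identify $\mathbb F_p$ with $\{0,1,\ldots,p-1\}$. For an integer $n=n_0+n_1p+\cdots+n_rp^r\ge 0$ written in base $p$ put $n(X)=n_0+n_1X+\cdots+n_rX^r\in\mathbb F_p[X]$. The Halton sequence in bases $b_1,\ldots,b_t$ is $\boldsymbol y_n=(y_n^{(1)},\ldots,y_n^{(t)})$, where $y_n^{(j)}=\sum_{i\ge 0}a_i(p)\,p^{-e_j(i+1)}$ and $n(X)=\sum_{i\ge 0}a_i(X)b_j(X)^i$ with $\deg a_i<e_j$. Let $\mathcal H$ be the compact group of all formal Laurent series $L=\sum_{i\ge1}a_iX^{-i}\in\mathbb F_p((X^{-1}))$, with its normalized Haar measure. For $L\in\mathcal H$ the digital Kronecker sequence $(x_n)_{n\ge0}$ associated with $L$ is defined by $x_n=\sum_{i\ge1}c_ip^{-i}$, where $\sum_{i\ge1}c_iX^{-i}$ is the fractional part of $n(X)L$. For a sequence $(\boldsymbol z_n)_{n\ge0}$ in dimension $d$, let $D_N=\sup_B\left|\frac1N\#\{0\le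 n<N:\boldsymbol z_n\in B\}-\lambda(B)\right|$, where $\lambda$ is Lebesgue measure and $B$ runs over the axis-parallel half-open boxes contained in $[0,1)^d$, and let $D_N^*$ be the same supremum over the boxes with lower left corner at the origin. Then for Haar-almost all $L\in\mathcal H$ the following holds: for every $\epsilon>0$ there is a constant $C$, depending only on $p,L,b_1,\ldots,b_t,\epsilon$, such that the discrepancy $D_N$ and the star discrepancy $D_N^*$ of the $(t+1)$-dimensional Kronecker–Halton sequence $(x_n,\boldsymbol y_n)_{n\ge0}$ satisfy $$N D_N\le C\,(\log N)^{t+1+\epsilon}\quad\text{and}\quad N D_N^*\le C\,(\log N)^{t+1+\epsilon}\qquad\text{for all } N\ge 2.$$ -/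

import Mathlib

open Polynomial MeasureTheory
open scoped LaurentSeries

namespace KroneckerHalton

noncomputable section

/-! ### Discrepancy -/

/-- The half-open axis-parallel box `∏ i, [u i, v i)`. -/
def box {d : ℕ} (u v : Fin d → ℝ) : Set (Fin d → ℝ) :=
  Set.univ.pi fun i => Set.Ico (u i) (v i)

/-- `A_N(B)`: the number of indices `0 ≤ n < N` with `z n ∈ B`. -/
def count {d : ℕ} (z : ℕ → Fin d → ℝ) (N : ℕ) (B : Set (Fin d → ℝ)) : ℕ :=
  {n : ℕ | n < N ∧ z n ∈ B}.ncard

/-- `|A_N(B) / N - λ(B)|`, where `λ` is the Lebesgue measure. -/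
def deviation {d : ℕ} (z : ℕ → Fin d → ℝ) (N : ℕ) (B : Set (Fin d → ℝ)) : ℝ :=
  |(count z N B : ℝ) / N - volume.real B|

/-- The discrepancy `D_N`: the supremum of the deviations over all axis-parallel boxes contained
in the unit cube `[0,1)^d`. (This is a supremum of a nonempty set of reals in `[0, 1]`.) -/
def discrepancy {d : ℕ} (z : ℕ → Fin d → ℝ) (N : ℕ) : ℝ :=
  sSup {r : ℝ | ∃ u v : Fin d → ℝ, (∀ i, 0 ≤ u i ∧ u i ≤ v i ∧ v i ≤ 1) ∧
    r = deviation z N (box u v)}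

/-- The star discrepancy `D_N^*`: only boxes with lower left corner in the origin are used. -/
def starDiscrepancy {d : ℕ} (z : ℕ → Fin d → ℝ) (N : ℕ) : ℝ :=
  sSup {r : ℝ | ∃ v : Fin d → ℝ, (∀ i, 0 ≤ v i ∧ v i ≤ 1) ∧
    r = deviation z N (box (fun _ => 0) v)}

/-! ### Polynomials attached to integers, and the Halton sequence -/

/-- `n(X) = n_0 + n_1 X + ⋯ + n_r X^r`, where `n = n_0 + n_1 p + ⋯ + n_r p^r` in base `p`. -/
def natPoly (p n : ℕ) : (ZMod p)[X] :=
  ∑ i ∈ Finset.range (Nat.digits p n).length,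
    monomial i (((Nat.digits p n).getD i 0 : ℕ) : ZMod p)

/-- `a(p)`: the value at `p` of the polynomial `a`, its coefficients being read as elements of
`{0, 1, …, p - 1}`. -/
def evalAtP (p : ℕ) (a : (ZMod p)[X]) : ℕ :=
  a.sum fun k c => c.val * p ^ k

/-- The digit `a_i` in the base `b` representation `f = a_0 + a_1 b + a_2 b^2 + ⋯` with
`deg a_i < deg b` (`b` monic and nonconstant). -/
def baseDigit {p : ℕ} (b f : (ZMod p)[X]) (i : ℕ) : (ZMod p)[X] :=
  (f /ₘ b ^ i) %ₘ b

/-- The van der Corput sequence in base `b`: `y_n = ∑ i, a_i(p) / p^(e (i + 1))`, where `e = deg b`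
and the `a_i` are the base `b` digits of `n(X)`; only finitely many terms are nonzero. -/
def vanDerCorput {p : ℕ} (b : (ZMod p)[X]) (n : ℕ) : ℝ :=
  ∑' i : ℕ, (evalAtP p (baseDigit b (natPoly p n) i) : ℝ) / (p : ℝ) ^ (b.natDegree * (i + 1))

/-- The Halton sequence in bases `b_1, …, b_t`. -/
def halton {p t : ℕ} (b : Fin t → (ZMod p)[X]) (n : ℕ) : Fin t → ℝ :=
  fun j => vanDerCorput (b j) n

/-! ### Laurent series in `X⁻¹`, and the Kronecker sequence

The field `F_p((X⁻¹))` is `(ZMod p)⸨X⸩`, with the uniformizer of the latter playing the role of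
`X⁻¹`: the series `∑ a_i X^(-i)` has `a_i` as its coefficient of index `i`. -/

variable {p : ℕ} [Fact p.Prime]

/-- The embedding of `F_p[X]` into `F_p((X⁻¹))`. -/
def polyToLaurent : (ZMod p)[X] →ₐ[ZMod p] (ZMod p)⸨X⸩ :=
  aeval (HahnSeries.single (-1 : ℤ) (1 : ZMod p))

/-- The fractional part `{L} = ∑_{i ≥ 1} a_i X^(-i)` of `L = ∑ a_i X^(-i)`. -/
def fracPart (L : (ZMod p)⸨X⸩) : (ZMod p)⸨X⸩ where
  coeff i := if 1 ≤ i then L.coeff i else 0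
  isPWO_support' := L.isPWO_support.mono fun i hi => by
    by_contra h
    simp_all [Function.mem_support]

/-- The value at `X = p` of a series `∑_{i ≥ 1} a_i X^(-i)`, the coefficients being read as elements
of `{0, 1, …, p - 1}`. -/
def evalFrac (F : (ZMod p)⸨X⸩) : ℝ :=
  ∑' i : ℕ, ((F.coeff ((i : ℤ) + 1)).val : ℝ) / (p : ℝ) ^ (i + 1)

/-- The digital Kronecker sequence associated with `L`. -/
def kronecker (L : (ZMod p)⸨X⸩) (n : ℕ) : ℝ :=
  evalFrac (fracPart (polyToLaurent (natPoly p n) * L))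

/-- The Kronecker-Halton sequence `(x_n, y_n)`. -/
def kroneckerHalton {t : ℕ} (L : (ZMod p)⸨X⸩) (b : Fin t → (ZMod p)[X]) (n : ℕ) :
    Fin (t + 1) → ℝ :=
  Fin.cons (kronecker L n) (halton b n)

/-! ### The compact group `𝓗` and its Haar measure -/

variable (p) in
/-- The group `𝓗` of all `L` in `F_p((X⁻¹))` with `ν(L) < 0`, that is `L = ∑_{i ≥ 1} a_i X^(-i)`.
Its topology is the one induced by the valuation of `F_p((X⁻¹))`. -/
def fracSeries : AddSubgroup (ZMod p)⸨X⸩ where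
  carrier := {L | ∀ i : ℤ, i ≤ 0 → L.coeff i = 0}
  zero_mem' := by simp
  add_mem' := by
    intro a b ha hb i hi
    simp [ha i hi, hb i hi]
  neg_mem' := by
    intro a ha i hi
    simp [ha i hi]

instance : MeasurableSpace (fracSeries p) := borel _

instance : BorelSpace (fracSeries p) := ⟨rfl⟩

variable (p) in
/-- The element `∑_{i ≥ 1} a_i X^(-i)` of `𝓗`. -/
def ofCoeffs (a : ℕ → ZMod p) : fracSeries p where
  val := HahnSeries.ofSuppBddBelow (fun i : ℤ => if 1 ≤ i then a i.toNat else 0)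
    ⟨1, fun i hi => not_lt.1 fun h => hi (if_neg (not_le.2 h))⟩
  property := fun i hi => if_neg (show ¬ 1 ≤ i by omega)

theorem coeff_ofCoeffs (a : ℕ → ZMod p) (i : ℤ) :
    (ofCoeffs p a : (ZMod p)⸨X⸩).coeff i = if 1 ≤ i then a i.toNat else 0 := rfl

theorem ofCoeffs_surjective : Function.Surjective (ofCoeffs p) := by
  rintro ⟨L, hL⟩
  refine ⟨fun n => L.coeff n, Subtype.ext ?_⟩
  ext i
  rw [coeff_ofCoeffs]
  by_cases h : 1 ≤ i
  · rw [if_pos h, Int.toNat_of_nonneg (by omega)]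
  · rw [if_neg h, hL i (by omega)]

theorem continuous_ofCoeffs :
    @Continuous _ _ (@Pi.topologicalSpace ℕ (fun _ => ZMod p) fun _ => ⊥) _ (ofCoeffs p) := by
  let _ : TopologicalSpace (ZMod p) := ⊥
  have _ : DiscreteTopology (ZMod p) := ⟨rfl⟩
  refine continuous_induced_rng.2 ?_
  refine continuous_iff_continuousAt.2 fun a s hs => ?_
  obtain ⟨γ, hγ⟩ := Valued.mem_nhds.1 hs
  have hne : MonoidWithZeroHom.ValueGroup₀.embedding γ.1 ≠
      (0 : WithZero (Multiplicative ℤ)) := by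
    simp
  obtain ⟨D, hD⟩ : ∃ D : ℤ, WithZero.exp (-D) <
      MonoidWithZeroHom.ValueGroup₀.embedding γ.1 := by
    refine ⟨1 - WithZero.log (MonoidWithZeroHom.ValueGroup₀.embedding γ.1), ?_⟩
    rw [← WithZero.lt_log_iff_exp_lt hne]
    omega
  have hU : {c : ℕ → ZMod p | ∀ n ∈ Finset.range D.toNat, c n = a n} ∈ nhds a := by
    have : {c : ℕ → ZMod p | ∀ n ∈ Finset.range D.toNat, c n = a n} =
        (Finset.range D.toNat : Set ℕ).pi fun n => {a n} := by
      ext c; simp [Set.mem_pi]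
    rw [this]
    exact set_pi_mem_nhds (Finset.finite_toSet _) fun n _ => by simp
  refine Filter.mem_map.2 (Filter.mem_of_superset hU fun c hc => hγ ?_)
  refine (Valuation.restrict_lt_iff_lt_embedding _).2 (lt_of_le_of_lt ?_ hD)
  refine (LaurentSeries.valuation_le_iff_coeff_lt_eq_zero (ZMod p)).2 fun n hn => ?_
  rw [HahnSeries.coeff_sub, Function.comp_apply, Function.comp_apply, coeff_ofCoeffs,
    coeff_ofCoeffs]
  by_cases h : 1 ≤ n
  · rw [hc n.toNat (by simp; omega), sub_self]
  · simp [h]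

instance : CompactSpace (fracSeries p) := by
  let _ : TopologicalSpace (ZMod p) := ⊥
  have _ : DiscreteTopology (ZMod p) := ⟨rfl⟩
  rw [← isCompact_univ_iff, ← ofCoeffs_surjective.range_eq]
  exact isCompact_range continuous_ofCoeffs

variable (p) in
/-- The normalized Haar measure `h` on `𝓗`: the Haar measure with `h(𝓗) = 1`. -/
def haar : Measure (fracSeries p) :=
  Measure.addHaarMeasure ⊤

end

end KroneckerHalton

/-! The integers below N < p^R are cut into blocks [a p^r, (a+1) p^r) with r < R, at most p of them
for each r. In a block, n(X) runs through X^r a(X) plus all polynomials of degree less than r. An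
elementary box of the Halton coordinates prescribes low base-b_j digits of n(X), that is, a residue
class modulo B = ∏ b_j^κ_j. Such a class meets the block in at most one point if deg B ≥ r, and
otherwise in the set of all F + B h with deg h < s, where s = r - deg B (`card_residue_le_one`,
`card_residue_block`).

On that set the first m Kronecker digits depend affinely on h, through the additive map `windowHom`
from F_p^s to F_p^m. If the map is surjective, every elementary interval of length p^(-m) gets
exactly p^(s-m) points; if not, the error is at most the size of the kernel
(`abs_card_fiber_sub_le`). Summing over all levels, N D_N is bounded by a constant times R^(t+1)
plus the total of these defects (`discrepancies_kroneckerHalton_le`). This part is deterministic,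
apart from excluding the null set of L for which some {n(X) L} has a digit expansion ending in p - 1
repeated.

The metric part estimates the defects for m ≤ s. For h ≠ 0 the first m coefficients of {B h L} are
uniformly distributed, so the mean kernel size is at most 1 + p^(s-m). The kernel always has at
least p^(s-m) elements, hence its excess over this value has mean at most 1 (`lintegral_excess_le`).
Without surjectivity the kernel has at least 2 p^(s-m) elements, so the excess dominates half the
defect and is at least p^(s-m).

Summing these means over every m would cost a factor R too much. Instead, by Markov, a defect with s
- m ≥ A occurs with probability at most 2^(-A); with R = 2^i and A = (t+3) i, Borel–Cantelli removes
all of these. The remaining s - m < A leave only R^(t+1) A terms, so the total defect is almost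
surely O(R^(t+1) (log R)^3) along R = 2^i (`ae_totalDefect_le`). Monotonicity in R covers the other
R, and R is of order log N. -/

namespace KroneckerHalton

/-! ### Digit expansions of real numbers -/

/-- The integer with base `Q` digits `d 0, d 1, …, d (k - 1)`, most significant digit first. -/
def digitPrefix (Q : ℕ) (d : ℕ → ℕ) : ℕ → ℕ
  | 0 => 0
  | k + 1 => Q * digitPrefix Q d k + d k

theorem digitPrefix_eq_iff {Q : ℕ} {d : ℕ → ℕ} (hd : ∀ i, d i < Q) (k c : ℕ) (hc : c < Q ^ k) :
    digitPrefix Q d k = c ↔ ∀ i < k, d i = c / Q ^ (k - 1 - i) % Q := by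
  have hQ : 0 < Q := (Nat.zero_le _).trans_lt (hd 0)
  induction k generalizing c with
  | zero => simp [digitPrefix]; simp at hc; exact hc.symm
  | succ k ih =>
    have h1 : digitPrefix Q d (k + 1) = c ↔ digitPrefix Q d k = c / Q ∧ d k = c % Q := by
      rw [digitPrefix]
      constructor
      · rintro rfl
        rw [Nat.mul_add_div hQ, Nat.div_eq_of_lt (hd k), Nat.mul_add_mod, Nat.mod_eq_of_lt (hd k)]
        simp
      · rintro ⟨h, h'⟩
        rw [h, h', Nat.div_add_mod]
    have hc' : c / Q < Q ^ k := Nat.div_lt_of_lt_mul (by rwa [pow_succ'] at hc)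
    refine h1.trans ((and_congr_left' (ih (c / Q) hc')).trans ?_)
    constructor
    · rintro ⟨h, h'⟩ i hi
      rcases Nat.lt_succ_iff_lt_or_eq.1 hi with hi | rfl
      · rw [h i hi, Nat.div_div_eq_div_mul, ← pow_succ',
          show k - 1 - i + 1 = k + 1 - 1 - i by omega]
      · simpa using h'
    · intro h
      refine ⟨fun i hi => ?_, by simpa using h k (Nat.lt_succ_self k)⟩
      rw [h i (by omega), Nat.div_div_eq_div_mul, ← pow_succ',
        show k - 1 - i + 1 = k + 1 - 1 - i by omega]

/-- Termwise comparison, strict at one place, with the expansion whose digits are all Q - 1. -/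
theorem ofDigits_lt_one {Q : ℕ} (a : ℕ → Fin Q) (h : ∃ i, (a i : ℕ) ≠ Q - 1) :
    Real.ofDigits a < 1 := by
  have hQ : 0 < Q := Fin.pos (a 0)
  let m : ℕ → Fin Q := fun _ => ⟨Q - 1, by omega⟩
  refine lt_of_lt_of_le ?_ (Real.ofDigits_le_one m)
  obtain ⟨i, hi⟩ := h
  refine Summable.tsum_lt_tsum (i := i) (fun j => ?_) ?_ Real.summable_ofDigitsTerm
    Real.summable_ofDigitsTerm
  · unfold Real.ofDigitsTerm
    gcongr
    have := (a j).2
    simp only [m]; omega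
  · unfold Real.ofDigitsTerm
    gcongr
    have := (a i).2
    simp only [m]; omega

theorem digitPrefix_eq_sum {Q : ℕ} (a : ℕ → Fin Q) (k : ℕ) :
    (digitPrefix Q (fun i => a i) k : ℝ) =
      (Q : ℝ) ^ k * ∑ i ∈ Finset.range k, Real.ofDigitsTerm a i := by
  have hQ : (Q : ℝ) ≠ 0 := Nat.cast_ne_zero.2 (Fin.pos (a 0)).ne'
  induction k with
  | zero => simp [digitPrefix]
  | succ k ih =>
    rw [digitPrefix, Finset.sum_range_succ]
    push_cast
    rw [ih, Real.ofDigitsTerm]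
    field_simp
    ring

/-- The real number with the base `Q` digits `d i` lies in `[0, 1)`, and its digits are the `d i`,
provided that these are not eventually equal to `Q - 1`. -/
theorem floor_digitSum {Q : ℕ} (d : ℕ → ℕ) (hd : ∀ i, d i < Q)
    (hinf : ∀ k, ∃ i ≥ k, d i ≠ Q - 1) (y : ℝ) (hy : y = ∑' i, (d i : ℝ) / (Q : ℝ) ^ (i + 1)) :
    0 ≤ y ∧ y < 1 ∧ ∀ k, ⌊(Q : ℝ) ^ k * y⌋₊ = digitPrefix Q d k := by
  let a : ℕ → Fin Q := fun i => ⟨d i, hd i⟩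
  have hQ : (Q : ℝ) ≠ 0 := Nat.cast_ne_zero.2 (Fin.pos (a 0)).ne'
  have hya : y = Real.ofDigits a := by
    rw [hy, Real.ofDigits]
    refine tsum_congr fun i => ?_
    rw [Real.ofDigitsTerm, div_eq_mul_inv]
  refine ⟨hya ▸ Real.ofDigits_nonneg a, ?_, fun k => ?_⟩
  · obtain ⟨i, -, hi⟩ := hinf 0
    exact hya ▸ ofDigits_lt_one a ⟨i, hi⟩
  · have h := Real.ofDigits_eq_sum_add_ofDigits a k
    have h2 : (Q : ℝ) ^ k * y = digitPrefix Q d k + Real.ofDigits (fun i => a (i + k)) := by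
      rw [hya, h, mul_add, show d = fun i => (a i : ℕ) from rfl, digitPrefix_eq_sum]
      field_simp
    have h3 : Real.ofDigits (fun i => a (i + k)) < 1 := by
      obtain ⟨i, hik, hi⟩ := hinf k
      refine ofDigits_lt_one _ ⟨i - k, ?_⟩
      simpa [a, Nat.sub_add_cancel hik] using hi
    rw [h2, Nat.floor_eq_iff (add_nonneg (Nat.cast_nonneg _) (Real.ofDigits_nonneg _))]
    exact ⟨le_add_of_nonneg_right (Real.ofDigits_nonneg _), by linarith⟩

/-! ### The bijection between integers and polynomials -/

section natPoly

variable {p : ℕ} [hp : Fact p.Prime]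

theorem coeff_natPoly (n i : ℕ) : (natPoly p n).coeff i = ((n / p ^ i % p : ℕ) : ZMod p) := by
  rw [natPoly, finsetSum_coeff, ← Nat.getD_digits _ _ hp.out.two_le]
  simp only [coeff_monomial]
  rw [Finset.sum_ite_eq' (Finset.range _) i]
  split_ifs with h
  · rfl
  · rw [List.getD_eq_default _ _ (by simpa using h)]
    simp

theorem natPoly_mul_add (n c : ℕ) (hc : c < p) :
    natPoly p (p * n + c) = X * natPoly p n + C (c : ZMod p) := by
  ext i
  rw [coeff_natPoly]
  cases i with
  | zero => simp [Nat.mod_eq_of_lt hc]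
  | succ i =>
    rw [coeff_add, coeff_X_mul, coeff_C_succ, add_zero, coeff_natPoly, pow_succ',
      ← Nat.div_div_eq_div_mul, Nat.mul_add_div hp.out.pos, Nat.div_eq_of_lt hc, add_zero]

theorem natPoly_zero : natPoly p 0 = 0 := by simp [natPoly]

theorem evalAtP_X_mul_add (f : (ZMod p)[X]) (c : ZMod p) :
    evalAtP p (X * f + C c) = p * evalAtP p f + c.val := by
  have key : ∀ g : (ZMod p)[X], ∀ n, g.natDegree < n →
      evalAtP p g = ∑ k ∈ Finset.range n, (g.coeff k).val * p ^ k := fun g n hn =>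
    sum_over_range' g (fun k => by simp) n hn
  have h1 : (X * f + C c).natDegree < f.natDegree + 2 := by
    refine lt_of_le_of_lt natDegree_add_C.le ?_
    have := natDegree_mul_le (p := (X : (ZMod p)[X])) (q := f)
    have := natDegree_X_le (R := ZMod p)
    omega
  rw [key _ _ h1, key f (f.natDegree + 1) (Nat.lt_succ_self _), Finset.sum_range_succ',
    Finset.mul_sum]
  congr 1
  · refine Finset.sum_congr rfl fun k _ => ?_
    rw [coeff_add, coeff_X_mul, coeff_C_succ, add_zero, pow_succ]
    ring
  · simp

theorem evalAtP_zero : evalAtP p (0 : (ZMod p)[X]) = 0 := by simp [evalAtP]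

theorem evalAtP_natPoly (n : ℕ) : evalAtP p (natPoly p n) = n := by
  induction n using Nat.strong_induction_on with
  | _ n ih =>
    rcases Nat.eq_zero_or_pos n with rfl | hn
    · rw [natPoly_zero, evalAtP_zero]
    · have hlt := Nat.mod_lt n hp.out.pos
      conv_lhs => rw [← Nat.div_add_mod n p]
      rw [natPoly_mul_add _ _ hlt, evalAtP_X_mul_add,
        ih _ (Nat.div_lt_self hn hp.out.one_lt), ZMod.val_natCast, Nat.mod_mod, Nat.div_add_mod]

theorem natPoly_evalAtP_aux (N : ℕ) (f : (ZMod p)[X]) (hf : f.natDegree < N) :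
    natPoly p (evalAtP p f) = f := by
  induction N generalizing f with
  | zero => omega
  | succ N ih =>
    by_cases h0 : f.natDegree = 0
    · rw [eq_C_of_natDegree_eq_zero h0, show C (f.coeff 0) = X * 0 + C (f.coeff 0) by simp,
        evalAtP_X_mul_add, natPoly_mul_add _ _ (ZMod.val_lt _), evalAtP_zero, natPoly_zero]
      simp
    · have h1 : (divX f).natDegree < N := by rw [natDegree_divX_eq_natDegree_tsub_one]; omega
      conv_lhs => rw [← X_mul_divX_add f]
      rw [evalAtP_X_mul_add, natPoly_mul_add _ _ (ZMod.val_lt _), ih _ h1, ZMod.natCast_val,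
        ZMod.cast_id, X_mul_divX_add]

theorem natPoly_evalAtP (f : (ZMod p)[X]) : natPoly p (evalAtP p f) = f :=
  natPoly_evalAtP_aux _ f (Nat.lt_succ_self _)

theorem natPoly_injective : Function.Injective (natPoly p) :=
  Function.LeftInverse.injective evalAtP_natPoly

theorem natPoly_ne_zero {n : ℕ} (hn : n ≠ 0) : natPoly p n ≠ 0 := fun h =>
  hn (natPoly_injective (h.trans natPoly_zero.symm))

/-- The integers `n` of the block `[a p^r, (a + 1) p^r)` are those for which `n(X)` agrees with
`X^r a(X)` up to a polynomial of degree less than `r`. -/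
theorem natPoly_block (a r n : ℕ) :
    n / p ^ r = a ↔ natPoly p n - X ^ r * natPoly p a ∈ degreeLT (ZMod p) r := by
  rw [mem_degreeLT, degree_lt_iff_coeff_zero]
  have hX : ∀ i, r ≤ i → (X ^ r * natPoly p a).coeff i = (natPoly p a).coeff (i - r) := by
    intro i hi
    rw [coeff_X_pow_mul', if_pos hi]
  constructor
  · rintro rfl i hi
    rw [coeff_sub, hX i hi, coeff_natPoly, coeff_natPoly, Nat.div_div_eq_div_mul, ← pow_add,
      Nat.add_sub_cancel' hi, sub_self]
  · intro h
    refine natPoly_injective (p := p) ?_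
    ext i
    have := h (i + r) (Nat.le_add_left _ _)
    rw [coeff_sub, hX _ (Nat.le_add_left _ _), Nat.add_sub_cancel, sub_eq_zero] at this
    rw [← this, coeff_natPoly, coeff_natPoly, Nat.div_div_eq_div_mul, ← pow_add, add_comm r]

theorem evalAtP_lt {e : ℕ} {f : (ZMod p)[X]} (hf : f ∈ degreeLT (ZMod p) e) :
    evalAtP p f < p ^ e := by
  have h := (natPoly_block 0 e (evalAtP p f)).2 (by
    rw [natPoly_evalAtP, natPoly_zero, mul_zero, sub_zero]; exact hf)
  exact (Nat.div_eq_zero_iff_lt (pow_pos hp.out.pos e)).1 h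

theorem natPoly_mem_degreeLT {e n : ℕ} (hn : n < p ^ e) : natPoly p n ∈ degreeLT (ZMod p) e := by
  have h := (natPoly_block (p := p) 0 e n).1 (Nat.div_eq_of_lt hn)
  rwa [natPoly_zero, mul_zero, sub_zero] at h

end natPoly

/-! ### Decomposition of boxes into elementary intervals -/

/-- The indices of the elementary intervals `[c / q^k, (c + 1) / q^k)` of level `k` in the
decomposition of `[0, v)`. -/
noncomputable def levelIndices (v : ℝ) (q : ℕ) : ℕ → Finset ℕ
  | 0 => Finset.range ⌊v⌋₊
  | k + 1 => Finset.Ico (q * ⌊(q : ℝ) ^ k * v⌋₊) ⌊(q : ℝ) ^ (k + 1) * v⌋₊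

theorem mul_floor_le_floor {v : ℝ} (hv : 0 ≤ v) (q k : ℕ) :
    q * ⌊(q : ℝ) ^ k * v⌋₊ ≤ ⌊(q : ℝ) ^ (k + 1) * v⌋₊ := by
  refine Nat.le_floor ?_
  push_cast
  rw [pow_succ', mul_assoc]
  gcongr
  exact Nat.floor_le (by positivity)

theorem lt_of_mem_levelIndices {v : ℝ} (hv1 : v ≤ 1) {q k c : ℕ}
    (hc : c ∈ levelIndices v q k) : c < q ^ k := by
  have h : c < ⌊(q : ℝ) ^ k * v⌋₊ := by
    cases k with
    | zero => simpa [levelIndices] using hc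
    | succ k => exact (Finset.mem_Ico.1 hc).2
  refine h.trans_le ?_
  have h2 : (q : ℝ) ^ k * v ≤ ((q ^ k : ℕ) : ℝ) := by
    push_cast
    exact mul_le_of_le_one_right (by positivity) hv1
  exact (Nat.floor_le_floor h2).trans (Nat.floor_natCast _).le

theorem card_levelIndices_le {v : ℝ} (hv : 0 ≤ v) (hv1 : v ≤ 1) {q : ℕ} (hq : 0 < q) (k : ℕ) :
    (levelIndices v q k).card ≤ q := by
  cases k with
  | zero =>
    rw [levelIndices, Finset.card_range]
    have : ⌊v⌋₊ ≤ 1 := by simpa using Nat.floor_le_floor hv1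
    omega
  | succ k =>
    rw [levelIndices, Nat.card_Ico]
    have h : ⌊(q : ℝ) ^ (k + 1) * v⌋₊ < q * ⌊(q : ℝ) ^ k * v⌋₊ + q := by
      rw [Nat.floor_lt (by positivity)]
      push_cast
      have := Nat.lt_floor_add_one ((q : ℝ) ^ k * v)
      have hq' : (0 : ℝ) < q := by exact_mod_cast hq
      calc (q : ℝ) ^ (k + 1) * v = q * ((q : ℝ) ^ k * v) := by ring
        _ < q * (⌊(q : ℝ) ^ k * v⌋₊ + 1) := by gcongr
        _ = _ := by ring
    omega

/-- The intervals of levels 0 to K tile [0, v) truncated to a multiple of q^(-K): level k + 1 adds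
exactly what lies between the truncations of v at levels k and k + 1. -/
theorem sum_levelIndices_indicator {z v : ℝ} (hz : 0 ≤ z) (hv : 0 ≤ v) {q : ℕ} (hq : 0 < q)
    (K : ℕ) :
    ∑ k ∈ Finset.range (K + 1), ∑ c ∈ levelIndices v q k,
      (if ⌊(q : ℝ) ^ k * z⌋₊ = c then (1 : ℝ) else 0) =
    if ⌊(q : ℝ) ^ K * z⌋₊ < ⌊(q : ℝ) ^ K * v⌋₊ then 1 else 0 := by
  induction K with
  | zero =>
    rw [zero_add, Finset.sum_range_one]
    simp [levelIndices]
  | succ K ih =>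
    rw [Finset.sum_range_succ, ih, levelIndices, Finset.sum_ite_eq]
    have h1 : ⌊(q : ℝ) ^ K * z⌋₊ < ⌊(q : ℝ) ^ K * v⌋₊ ↔
        ⌊(q : ℝ) ^ (K + 1) * z⌋₊ < q * ⌊(q : ℝ) ^ K * v⌋₊ := by
      rw [Nat.floor_lt (by positivity), Nat.floor_lt (by positivity)]
      push_cast
      rw [pow_succ', mul_assoc, mul_lt_mul_iff_right₀ (by exact_mod_cast hq)]
    have h2 := mul_floor_le_floor hv q K
    simp only [Finset.mem_Ico]
    by_cases ha : ⌊(q : ℝ) ^ (K + 1) * z⌋₊ < q * ⌊(q : ℝ) ^ K * v⌋₊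
    · rw [if_pos (h1.2 ha), if_neg (by omega), if_pos (by omega), add_zero]
    · rw [if_neg (fun h => ha (h1.1 h)), zero_add]
      exact if_congr (by omega) rfl rfl

theorem sum_levelIndices_length {v : ℝ} (hv : 0 ≤ v) {q : ℕ} (hq : 0 < q) (K : ℕ) :
    ∑ k ∈ Finset.range (K + 1), ∑ _c ∈ levelIndices v q k, ((q : ℝ) ^ k)⁻¹ =
      ⌊(q : ℝ) ^ K * v⌋₊ * ((q : ℝ) ^ K)⁻¹ := by
  have hq' : (q : ℝ) ≠ 0 := by exact_mod_cast hq.ne'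
  induction K with
  | zero => simp [levelIndices]
  | succ K ih =>
    rw [Finset.sum_range_succ, ih, levelIndices, Finset.sum_const, Nat.card_Ico, nsmul_eq_mul,
      Nat.cast_sub (mul_floor_le_floor hv q K)]
    push_cast
    field_simp
    ring

/-- Truncating v changes the verdict only for points in the same level-K interval as v. These points
form the boundary term of the box estimates. -/
theorem abs_indicator_sub_le {z v : ℝ} {q : ℕ} (hq : 0 < q)
    (K : ℕ) :
    |(if z < v then (1 : ℝ) else 0) -
      (if ⌊(q : ℝ) ^ K * z⌋₊ < ⌊(q : ℝ) ^ K * v⌋₊ then 1 else 0)| ≤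
      if ⌊(q : ℝ) ^ K * z⌋₊ = ⌊(q : ℝ) ^ K * v⌋₊ then 1 else 0 := by
  have hq' : (0 : ℝ) < (q : ℝ) ^ K := by positivity
  by_cases h : z < v
  · have h1 : ⌊(q : ℝ) ^ K * z⌋₊ ≤ ⌊(q : ℝ) ^ K * v⌋₊ := Nat.floor_le_floor (by gcongr)
    rcases h1.lt_or_eq with h2 | h2
    · simp [h, h2, h2.ne]
    · simp [h, h2]
  · have h1 : ⌊(q : ℝ) ^ K * v⌋₊ ≤ ⌊(q : ℝ) ^ K * z⌋₊ :=
      Nat.floor_le_floor (by have := not_lt.1 h; gcongr)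
    rw [if_neg h, if_neg (not_lt.2 h1)]
    split_ifs <;> simp

theorem abs_sub_floor_le {v : ℝ} (hv : 0 ≤ v) {q : ℕ} (hq : 0 < q) (K : ℕ) :
    |v - ⌊(q : ℝ) ^ K * v⌋₊ * ((q : ℝ) ^ K)⁻¹| ≤ ((q : ℝ) ^ K)⁻¹ := by
  have hq' : (0 : ℝ) < (q : ℝ) ^ K := by positivity
  have h1 := Nat.floor_le (a := (q : ℝ) ^ K * v) (by positivity)
  have h2 := Nat.lt_floor_add_one ((q : ℝ) ^ K * v)
  rw [← mul_le_mul_iff_right₀ hq', mul_inv_cancel₀ hq'.ne', ← abs_of_pos hq', ← abs_mul,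
    abs_of_pos hq', mul_sub, mul_left_comm, mul_inv_cancel₀ hq'.ne', mul_one, abs_le]
  constructor <;> linarith

theorem abs_prod_sub_prod_le {ι : Type*} (s : Finset ι) (f g : ι → ℝ)
    (hf0 : ∀ i, 0 ≤ f i) (hf1 : ∀ i, f i ≤ 1) (hg0 : ∀ i, 0 ≤ g i) (hg1 : ∀ i, g i ≤ 1) :
    |∏ i ∈ s, f i - ∏ i ∈ s, g i| ≤ ∑ i ∈ s, |f i - g i| := by
  classical
  induction s using Finset.induction_on with
  | empty => simp
  | insert a s ha ih =>
    rw [Finset.prod_insert ha, Finset.prod_insert ha, Finset.sum_insert ha]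
    have h1 : f a * ∏ i ∈ s, f i - g a * ∏ i ∈ s, g i =
        (f a - g a) * ∏ i ∈ s, f i + g a * (∏ i ∈ s, f i - ∏ i ∈ s, g i) := by ring
    rw [h1]
    refine (abs_add_le _ _).trans (add_le_add ?_ ?_)
    · rw [abs_mul]
      refine mul_le_of_le_one_right (abs_nonneg _) ?_
      rw [abs_of_nonneg (Finset.prod_nonneg fun i _ => hf0 i)]
      exact Finset.prod_le_one (fun i _ => hf0 i) fun i _ => hf1 i
    · rw [abs_mul, abs_of_nonneg (hg0 a)]
      exact (mul_le_of_le_one_left (abs_nonneg _) (hg1 a)).trans ih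

/-- The local discrepancy of `[0, v)` in terms of those of elementary intervals. -/
theorem interval_error_le {α : Type*} (P : Finset α) (z : α → ℝ) (hz : ∀ n ∈ P, 0 ≤ z n) {v : ℝ}
    (hv : 0 ≤ v) (hv1 : v ≤ 1) {q : ℕ} (hq : 0 < q) (K : ℕ) (M : ℝ) (hM : 0 ≤ M) (E : ℕ → ℝ)
    (hE : ∀ k ≤ K, ∀ c < q ^ k,
      |((P.filter fun n => ⌊(q : ℝ) ^ k * z n⌋₊ = c).card : ℝ) - M * ((q : ℝ) ^ k)⁻¹| ≤ E k) :
    |((P.filter fun n => z n < v).card : ℝ) - M * v| ≤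
      ∑ k ∈ Finset.range (K + 1), q * E k +
        ((P.filter fun n => ⌊(q : ℝ) ^ K * z n⌋₊ = ⌊(q : ℝ) ^ K * v⌋₊).card +
          M * ((q : ℝ) ^ K)⁻¹) := by
  have hE0 : ∀ k ≤ K, 0 ≤ E k := fun k hk =>
    (abs_nonneg _).trans (hE k hk 0 (pow_pos hq k))
  have hcard : ∀ (Q : α → Prop) [DecidablePred Q],
      ((P.filter Q).card : ℝ) = ∑ n ∈ P, if Q n then (1 : ℝ) else 0 := fun Q _ => by
    rw [Finset.sum_boole]
  have h1 : |((P.filter fun n => z n < v).card : ℝ) - ((P.filter fun n =>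
      ⌊(q : ℝ) ^ K * z n⌋₊ < ⌊(q : ℝ) ^ K * v⌋₊).card : ℝ)| ≤
      (P.filter fun n => ⌊(q : ℝ) ^ K * z n⌋₊ = ⌊(q : ℝ) ^ K * v⌋₊).card := by
    rw [hcard, hcard, hcard, ← Finset.sum_sub_distrib]
    exact (Finset.abs_sum_le_sum_abs _ _).trans
      (Finset.sum_le_sum fun n _ => abs_indicator_sub_le hq K)
  have h2 : |M * (⌊(q : ℝ) ^ K * v⌋₊ * ((q : ℝ) ^ K)⁻¹) - M * v| ≤ M * ((q : ℝ) ^ K)⁻¹ := by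
    rw [← mul_sub, abs_mul, abs_of_nonneg hM, abs_sub_comm]
    exact mul_le_mul_of_nonneg_left (abs_sub_floor_le hv hq K) hM
  have h3 : |((P.filter fun n => ⌊(q : ℝ) ^ K * z n⌋₊ < ⌊(q : ℝ) ^ K * v⌋₊).card : ℝ) -
      M * (⌊(q : ℝ) ^ K * v⌋₊ * ((q : ℝ) ^ K)⁻¹)| ≤ ∑ k ∈ Finset.range (K + 1), q * E k := by
    have h4 : ((P.filter fun n => ⌊(q : ℝ) ^ K * z n⌋₊ < ⌊(q : ℝ) ^ K * v⌋₊).card : ℝ) =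
        ∑ k ∈ Finset.range (K + 1), ∑ c ∈ levelIndices v q k,
          ((P.filter fun n => ⌊(q : ℝ) ^ k * z n⌋₊ = c).card : ℝ) := by
      simp_rw [hcard]
      rw [Finset.sum_congr rfl fun n hn => (sum_levelIndices_indicator (hz n hn) hv hq K).symm,
        Finset.sum_comm]
      exact Finset.sum_congr rfl fun k _ => Finset.sum_comm
    rw [h4, ← sum_levelIndices_length hv hq K, Finset.mul_sum, ← Finset.sum_sub_distrib]
    refine (Finset.abs_sum_le_sum_abs _ _).trans (Finset.sum_le_sum fun k hk => ?_)
    have hk' : k ≤ K := Nat.lt_succ_iff.1 (Finset.mem_range.1 hk)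
    rw [Finset.mul_sum, ← Finset.sum_sub_distrib]
    refine (Finset.abs_sum_le_sum_abs _ _).trans ?_
    refine (Finset.sum_le_card_nsmul _ _ (E k)
      fun c hc => hE k hk' c (lt_of_mem_levelIndices hv1 hc)).trans ?_
    rw [nsmul_eq_mul]
    exact mul_le_mul_of_nonneg_right (by exact_mod_cast card_levelIndices_le hv hv1 hq k) (hE0 k hk')
  have h5 := abs_add_three (((P.filter fun n => z n < v).card : ℝ) - ((P.filter fun n =>
      ⌊(q : ℝ) ^ K * z n⌋₊ < ⌊(q : ℝ) ^ K * v⌋₊).card : ℝ))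
      (((P.filter fun n => ⌊(q : ℝ) ^ K * z n⌋₊ < ⌊(q : ℝ) ^ K * v⌋₊).card : ℝ) -
      M * (⌊(q : ℝ) ^ K * v⌋₊ * ((q : ℝ) ^ K)⁻¹))
      (M * (⌊(q : ℝ) ^ K * v⌋₊ * ((q : ℝ) ^ K)⁻¹) - M * v)
  rw [sub_add_sub_cancel, sub_add_sub_cancel] at h5
  linarith

/-- The local discrepancy of a box `∏ j, [0, v j)`, the points `n` being counted with the weight
`w n`, in terms of those of elementary boxes. -/
theorem box_error_le {α ι : Type*} [Fintype ι] [DecidableEq ι] (P : Finset α) (z : α → ι → ℝ)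
    (hz : ∀ n ∈ P, ∀ j, 0 ≤ z n j) {v : ι → ℝ} (hv : ∀ j, 0 ≤ v j) (hv1 : ∀ j, v j ≤ 1)
    {q : ι → ℕ} (hq : ∀ j, 0 < q j) (K : ℕ) (w : α → ℝ) (hw : ∀ n, 0 ≤ w n) (hw1 : ∀ n, w n ≤ 1)
    (W : ℝ) (hW : 0 ≤ W) (E : (ι → ℕ) → ℝ)
    (hE : ∀ κ : ι → ℕ, (∀ j, κ j ≤ K) → ∀ c : ι → ℕ, (∀ j, c j < q j ^ κ j) →
      |∑ n ∈ P, w n * (∏ j, if ⌊(q j : ℝ) ^ κ j * z n j⌋₊ = c j then (1 : ℝ) else 0) -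
        W * ∏ j, ((q j : ℝ) ^ κ j)⁻¹| ≤ E κ) :
    |∑ n ∈ P, w n * (∏ j, if z n j < v j then (1 : ℝ) else 0) - W * ∏ j, v j| ≤
      (∏ j, (q j : ℝ)) * ∑ κ ∈ Fintype.piFinset fun _ : ι => Finset.range (K + 1), E κ +
        ∑ j, (((P.filter fun n => ⌊(q j : ℝ) ^ K * z n j⌋₊ = ⌊(q j : ℝ) ^ K * v j⌋₊).card : ℝ) +
          W * ((q j : ℝ) ^ K)⁻¹) := by
  let g : α → ι → ℝ := fun n j => if z n j < v j then 1 else 0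
  let G : α → ι → ℝ := fun n j =>
    if ⌊(q j : ℝ) ^ K * z n j⌋₊ < ⌊(q j : ℝ) ^ K * v j⌋₊ then 1 else 0
  let V : ι → ℝ := fun j => ⌊(q j : ℝ) ^ K * v j⌋₊ * ((q j : ℝ) ^ K)⁻¹
  have hE0 : ∀ κ : ι → ℕ, (∀ j, κ j ≤ K) → 0 ≤ E κ := fun κ hκ =>
    (abs_nonneg _).trans (hE κ hκ (fun _ => 0) fun j => pow_pos (hq j) _)
  have hb0 : ∀ (Q : Prop) [Decidable Q], 0 ≤ (if Q then (1 : ℝ) else 0) := fun Q _ => by split_ifs <;> simp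
  have hb1 : ∀ (Q : Prop) [Decidable Q], (if Q then (1 : ℝ) else 0) ≤ 1 := fun Q _ => by split_ifs <;> simp
  have hV0 : ∀ j, 0 ≤ V j := fun j => by positivity
  have hV1 : ∀ j, V j ≤ 1 := fun j => by
    have hq' : (0 : ℝ) < (q j : ℝ) ^ K := pow_pos (by exact_mod_cast hq j) _
    simp only [V]
    rw [← div_eq_mul_inv, div_le_one hq']
    exact (Nat.floor_le (mul_nonneg hq'.le (hv j))).trans
      (mul_le_of_le_one_right hq'.le (hv1 j))
  have h1 : |∑ n ∈ P, w n * ∏ j, g n j - ∑ n ∈ P, w n * ∏ j, G n j| ≤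
      ∑ j, ((P.filter fun n => ⌊(q j : ℝ) ^ K * z n j⌋₊ = ⌊(q j : ℝ) ^ K * v j⌋₊).card : ℝ) := by
    rw [← Finset.sum_sub_distrib]
    refine (Finset.abs_sum_le_sum_abs _ _).trans ?_
    simp_rw [← Finset.sum_boole]
    rw [Finset.sum_comm]
    refine Finset.sum_le_sum fun n hn => ?_
    rw [← mul_sub, abs_mul, abs_of_nonneg (hw n)]
    refine (mul_le_of_le_one_left (abs_nonneg _) (hw1 n)).trans ?_
    refine (abs_prod_sub_prod_le _ _ _ (fun j => hb0 _) (fun j => hb1 _) (fun j => hb0 _)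
      (fun j => hb1 _)).trans (Finset.sum_le_sum fun j _ => ?_)
    exact abs_indicator_sub_le (hq j) K
  have h2 : |W * ∏ j, V j - W * ∏ j, v j| ≤ ∑ j, W * ((q j : ℝ) ^ K)⁻¹ := by
    rw [← mul_sub, abs_mul, abs_of_nonneg hW, ← Finset.mul_sum]
    refine mul_le_mul_of_nonneg_left ?_ hW
    refine (abs_prod_sub_prod_le _ _ _ hV0 hV1 hv hv1).trans (Finset.sum_le_sum fun j _ => ?_)
    rw [abs_sub_comm]
    exact abs_sub_floor_le (hv j) (hq j) K
  have h3 : |∑ n ∈ P, w n * ∏ j, G n j - W * ∏ j, V j| ≤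
      (∏ j, (q j : ℝ)) * ∑ κ ∈ Fintype.piFinset fun _ : ι => Finset.range (K + 1), E κ := by
    have h4 : ∑ n ∈ P, w n * ∏ j, G n j =
        ∑ κ ∈ Fintype.piFinset fun _ : ι => Finset.range (K + 1),
          ∑ c ∈ Fintype.piFinset fun j => levelIndices (v j) (q j) (κ j),
          ∑ n ∈ P, w n * ∏ j, if ⌊(q j : ℝ) ^ κ j * z n j⌋₊ = c j then (1 : ℝ) else 0 := by
      -- Once the sum over points is outermost, the product over coordinates of the one-dimensional
      -- tilings expands into elementary boxes, indexed by the level vector κ and the position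
      -- vector c.
      rw [Finset.sum_congr rfl fun κ _ => Finset.sum_comm, Finset.sum_comm]
      refine Finset.sum_congr rfl fun n hn => ?_
      rw [Finset.prod_congr rfl fun j _ =>
        (sum_levelIndices_indicator (hz n hn j) (hv j) (hq j) K).symm, Finset.prod_univ_sum,
        Finset.mul_sum]
      refine Finset.sum_congr rfl fun κ _ => ?_
      rw [Finset.prod_univ_sum, Finset.mul_sum]
    have h5 : W * ∏ j, V j =
        ∑ κ ∈ Fintype.piFinset fun _ : ι => Finset.range (K + 1),
          ∑ c ∈ Fintype.piFinset fun j => levelIndices (v j) (q j) (κ j),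
          W * ∏ j, ((q j : ℝ) ^ κ j)⁻¹ := by
      rw [Finset.prod_congr rfl fun j _ => (sum_levelIndices_length (hv j) (hq j) K).symm,
        Finset.prod_univ_sum, Finset.mul_sum]
      refine Finset.sum_congr rfl fun κ _ => ?_
      rw [Finset.prod_univ_sum, Finset.mul_sum]
    rw [h4, h5, ← Finset.sum_sub_distrib, Finset.mul_sum]
    refine (Finset.abs_sum_le_sum_abs _ _).trans (Finset.sum_le_sum fun κ hκ => ?_)
    have hκ' : ∀ j, κ j ≤ K := fun j =>
      Nat.lt_succ_iff.1 (Finset.mem_range.1 (Fintype.mem_piFinset.1 hκ j))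
    rw [← Finset.sum_sub_distrib]
    refine (Finset.abs_sum_le_sum_abs _ _).trans ?_
    refine (Finset.sum_le_card_nsmul _ _ (E κ) fun c hc => hE κ hκ' c fun j =>
      lt_of_mem_levelIndices (hv1 j) (Fintype.mem_piFinset.1 hc j)).trans ?_
    rw [nsmul_eq_mul, Fintype.card_piFinset]
    refine mul_le_mul_of_nonneg_right ?_ (hE0 κ hκ')
    push_cast
    exact Finset.prod_le_prod (fun j _ => Nat.cast_nonneg _) fun j _ => by
      exact_mod_cast card_levelIndices_le (hv j) (hv1 j) (hq j) (κ j)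
  have h6 := abs_add_three (∑ n ∈ P, w n * ∏ j, g n j - ∑ n ∈ P, w n * ∏ j, G n j)
    (∑ n ∈ P, w n * ∏ j, G n j - W * ∏ j, V j) (W * ∏ j, V j - W * ∏ j, v j)
  rw [sub_add_sub_cancel, sub_add_sub_cancel] at h6
  rw [Finset.sum_add_distrib]
  linarith

/-! ### Sums over initial segments of the integers -/

/-- The leading base-p digit of N gives fewer than p full blocks. The remainder again starts at a
multiple of the block length, which is why the induction allows an arbitrary starting index a. -/
theorem abs_sum_le_of_blocks {p : ℕ} (f : ℕ → ℝ) (E : ℕ → ℝ) (hE0 : ∀ r, 0 ≤ E r)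
    (hE : ∀ r a, |∑ n ∈ Finset.Ico (a * p ^ r) ((a + 1) * p ^ r), f n| ≤ E r) (R : ℕ) :
    ∀ a N, N < p ^ R → |∑ n ∈ Finset.Ico (a * p ^ R) (a * p ^ R + N), f n| ≤
      ∑ r ∈ Finset.range R, p * E r := by
  induction R with
  | zero =>
    intro a N hN
    have : N = 0 := by simpa using hN
    simp [this]
  | succ R ih =>
    intro a N hN
    have hR : 0 < p ^ R := by
      rcases Nat.eq_zero_or_pos p with rfl | hp
      · simp at hN
      · exact pow_pos hp R
    have hblocks : ∀ d b : ℕ, |∑ n ∈ Finset.Ico (b * p ^ R) ((b + d) * p ^ R), f n| ≤ d * E R := by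
      intro d b
      induction d with
      | zero => simp
      | succ d ihd =>
        rw [← Finset.sum_Ico_consecutive f (n := (b + d) * p ^ R)
          (Nat.mul_le_mul_right _ (by omega)) (Nat.mul_le_mul_right _ (by omega))]
        refine (abs_add_le _ _).trans ?_
        have := hE R (b + d)
        rw [add_assoc] at this
        push_cast
        linarith
    have hd : N / p ^ R < p := Nat.div_lt_of_lt_mul (by rwa [pow_succ] at hN)
    have hN' : N = N / p ^ R * p ^ R + N % p ^ R := (Nat.div_add_mod' N (p ^ R)).symm
    have h1 : a * p ^ (R + 1) = a * p * p ^ R := by ring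
    have h2 : a * p ^ (R + 1) + N = (a * p + N / p ^ R) * p ^ R + N % p ^ R := by
      rw [h1, add_mul, add_assoc, ← hN']
    rw [h2, h1, ← Finset.sum_Ico_consecutive f (n := (a * p + N / p ^ R) * p ^ R)
      (Nat.mul_le_mul_right _ (Nat.le_add_right _ _)) (Nat.le_add_right _ _),
      Finset.sum_range_succ, add_comm]
    refine (abs_add_le _ _).trans (add_le_add (ih _ _ (Nat.mod_lt _ hR)) ?_)
    refine (hblocks _ _).trans (mul_le_mul_of_nonneg_right (by exact_mod_cast hd.le) (hE0 R))

/-! ### Reduction of the discrepancy to boxes with a corner at the origin -/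

theorem prod_sub_eq_sum_piecewise {ι : Type*} [Fintype ι] [DecidableEq ι] (f g : ι → ℝ) :
    ∏ j, (f j - g j) =
      ∑ s ∈ (Finset.univ : Finset ι).powerset, (-1) ^ s.card * ∏ j, if j ∈ s then g j else f j := by
  rw [Finset.prod_sub]
  refine Finset.sum_congr rfl fun s _ => ?_
  rw [Finset.prod_ite, Finset.filter_mem_eq_inter, Finset.univ_inter, mul_assoc,
    mul_comm (∏ j ∈ s, g j)]
  congr 3
  ext; simp

theorem count_eq_sum {d : ℕ} (z : ℕ → Fin d → ℝ) (N : ℕ) (u v : Fin d → ℝ) :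
    (count z N (box u v) : ℝ) =
      ∑ n ∈ Finset.range N, ∏ j, if u j ≤ z n j ∧ z n j < v j then (1 : ℝ) else 0 := by
  have h : {n : ℕ | n < N ∧ z n ∈ box u v} =
      ((Finset.range N).filter fun n => ∀ j, u j ≤ z n j ∧ z n j < v j : Finset ℕ) := by
    ext n
    simp [box, Set.mem_pi]
  rw [count, h, Set.ncard_coe_finset, ← Finset.sum_boole]
  refine Finset.sum_congr rfl fun n _ => ?_
  rw [Fintype.prod_boole]
  by_cases hn : ∀ j, u j ≤ z n j ∧ z n j < v j
  · rw [if_pos hn, if_pos hn]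
  · rw [if_neg hn, if_neg hn]

theorem mul_deviation_box {d : ℕ} (z : ℕ → Fin d → ℝ) {N : ℕ} (hN : N ≠ 0) {u v : Fin d → ℝ}
    (huv : ∀ j, u j ≤ v j) :
    N * deviation z N (box u v) =
      |∑ n ∈ Finset.range N, ∏ j, (if u j ≤ z n j ∧ z n j < v j then (1 : ℝ) else 0) -
        N * ∏ j, (v j - u j)| := by
  have hN' : (N : ℝ) ≠ 0 := Nat.cast_ne_zero.2 hN
  have hvol : volume.real (box u v) = ∏ j, (v j - u j) :=
    Real.volume_pi_Ico_toReal huv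
  rw [deviation, hvol, count_eq_sum]
  nth_rewrite 1 [← abs_of_nonneg (Nat.cast_nonneg (α := ℝ) N)]
  rw [← abs_mul, mul_sub, mul_div_cancel₀ _ hN']

/-- Inclusion–exclusion over the 2^d corners expresses a box through boxes anchored at the origin.
-/
theorem discrepancies_le {d : ℕ} (z : ℕ → Fin d → ℝ) {N : ℕ} (hN : N ≠ 0) (T : ℝ)
    (hT : ∀ w : Fin d → ℝ, (∀ j, 0 ≤ w j) → (∀ j, w j ≤ 1) →
      |∑ n ∈ Finset.range N, ((∏ j, if z n j < w j then (1 : ℝ) else 0) - ∏ j, w j)| ≤ T) :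
    N * discrepancy z N ≤ 2 ^ d * T ∧ N * starDiscrepancy z N ≤ 2 ^ d * T := by
  have hN' : (0 : ℝ) < N := Nat.cast_pos.2 (Nat.pos_of_ne_zero hN)
  have hT0 : 0 ≤ T := (abs_nonneg _).trans (hT (fun _ => 0) (fun _ => le_rfl) fun _ => zero_le_one)
  have key : ∀ u v : Fin d → ℝ, (∀ j, 0 ≤ u j ∧ u j ≤ v j ∧ v j ≤ 1) →
      N * deviation z N (box u v) ≤ 2 ^ d * T := by
    intro u v huv
    rw [mul_deviation_box z hN fun j => (huv j).2.1]
    have h1 : ∀ n, ∏ j, (if u j ≤ z n j ∧ z n j < v j then (1 : ℝ) else 0) =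
        ∑ s ∈ (Finset.univ : Finset (Fin d)).powerset, (-1) ^ s.card *
          ∏ j, if z n j < (if j ∈ s then u j else v j) then (1 : ℝ) else 0 := by
      intro n
      have : ∀ j, (if u j ≤ z n j ∧ z n j < v j then (1 : ℝ) else 0) =
          (if z n j < v j then 1 else 0) - if z n j < u j then 1 else 0 := by
        intro j
        have := (huv j).2.1
        by_cases h : z n j < u j
        · rw [if_neg (fun h' => not_lt.2 h'.1 h), if_pos (h.trans_le this), if_pos h, sub_self]
        · rw [if_neg h, sub_zero]
          exact if_congr (by simp [not_lt.1 h]) rfl rfl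
      simp_rw [this]
      rw [prod_sub_eq_sum_piecewise]
      refine Finset.sum_congr rfl fun s _ => ?_
      congr 1
      refine Finset.prod_congr rfl fun j _ => ?_
      split_ifs <;> rfl
    have h2 : ∏ j, (v j - u j) = ∑ s ∈ (Finset.univ : Finset (Fin d)).powerset,
        (-1) ^ s.card * ∏ j, if j ∈ s then u j else v j := prod_sub_eq_sum_piecewise v u
    have h3 : (N : ℝ) * ∏ j, (v j - u j) = ∑ _n ∈ Finset.range N, ∏ j, (v j - u j) := by
      rw [Finset.sum_const, Finset.card_range, nsmul_eq_mul]
    rw [h3, ← Finset.sum_sub_distrib, h2]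
    simp_rw [h1, ← Finset.sum_sub_distrib, ← mul_sub]
    rw [Finset.sum_comm]
    refine (Finset.abs_sum_le_sum_abs _ _).trans ?_
    refine (Finset.sum_le_card_nsmul _ _ T fun s _ => ?_).trans ?_
    · rw [← Finset.mul_sum, abs_mul, abs_pow, abs_neg, abs_one, one_pow, one_mul]
      refine hT _ (fun j => ?_) fun j => ?_
      · have := huv j
        split_ifs <;> linarith
      · have := huv j
        split_ifs <;> linarith
    · rw [Finset.card_powerset, Finset.card_univ, Fintype.card_fin, nsmul_eq_mul]
      push_cast
      rfl
  have hB : 0 ≤ 2 ^ d * T / N := by positivity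
  constructor
  · rw [← le_div_iff₀' hN']
    refine Real.sSup_le ?_ hB
    rintro r ⟨u, v, huv, rfl⟩
    rw [le_div_iff₀' hN']
    exact key u v huv
  · rw [← le_div_iff₀' hN']
    refine Real.sSup_le ?_ hB
    rintro r ⟨v, hv, rfl⟩
    rw [le_div_iff₀' hN']
    exact key _ v fun j => ⟨le_rfl, hv j⟩

/-! ### Haar measure -/

section Haar

variable {p : ℕ} [hp : Fact p.Prime]

theorem coeff_polyToLaurent (q : (ZMod p)[X]) (k : ℕ) :
    (polyToLaurent q).coeff (-(k : ℤ)) = q.coeff k := by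
  rw [polyToLaurent, aeval_def, Subsingleton.elim (algebraMap (ZMod p) (ZMod p)⸨X⸩) HahnSeries.C,
    eval₂_eq_sum_range' _ (Nat.lt_succ_of_le (le_max_left q.natDegree k))]
  simp only [HahnSeries.single_pow, one_pow, HahnSeries.coeff_sum, HahnSeries.C_apply,
    HahnSeries.single_mul_single, zero_add, mul_one]
  rw [Finset.sum_eq_single k]
  · simp
  · intro b _ hb
    exact HahnSeries.coeff_single_of_ne (by simpa using hb.symm)
  · intro h
    exact absurd (Finset.mem_range.2 (Nat.lt_succ_of_le (le_max_right _ _))) h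

theorem one_le_valuation_polyToLaurent {q : (ZMod p)[X]} (hq : q ≠ 0) :
    1 ≤ Valued.v (polyToLaurent q) := by
  by_contra h
  have h1 : Valued.v (polyToLaurent q) ≤ WithZero.exp (-(1 : ℤ)) := by
    rw [not_le, ← WithZero.exp_zero] at h
    rcases eq_or_ne (Valued.v (polyToLaurent q)) 0 with h0 | h0
    · rw [h0]; exact zero_le
    · rw [← WithZero.log_lt_iff_lt_exp h0] at h
      rw [← WithZero.log_le_iff_le_exp h0]
      omega
  have h2 := (LaurentSeries.valuation_le_iff_coeff_lt_eq_zero (ZMod p)).1 h1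
    (-(q.natDegree : ℤ)) (by omega)
  rw [coeff_polyToLaurent] at h2
  exact hq (leadingCoeff_eq_zero.1 h2)

/-- The coefficients of index `i + 1, …, i + m` of `q L`. -/
noncomputable def coeffWindow (q : (ZMod p)[X]) (i m : ℕ) : fracSeries p →+ (Fin m → ZMod p) where
  toFun L j := (polyToLaurent q * (L : (ZMod p)⸨X⸩)).coeff ((i + j : ℕ) + 1 : ℤ)
  map_zero' := by ext; simp
  map_add' L L' := by ext; simp [mul_add]

/-- Division is possible in F_p((X⁻¹)): L = T / q works for any T with the wanted coefficients. It
stays in 𝓗 because a nonzero polynomial has absolute value at least 1. -/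
theorem coeffWindow_surjective {q : (ZMod p)[X]} (hq : q ≠ 0) (i m : ℕ) :
    Function.Surjective (coeffWindow q i m) := by
  intro c
  let T : (ZMod p)⸨X⸩ := ∑ j : Fin m, HahnSeries.single ((i + j : ℕ) + 1 : ℤ) (c j)
  have hq0 : polyToLaurent q ≠ 0 := fun h => by
    have := one_le_valuation_polyToLaurent hq
    simp [h] at this
  have hT : Valued.v T ≤ WithZero.exp (-(1 : ℤ)) := by
    refine (LaurentSeries.valuation_le_iff_coeff_lt_eq_zero (ZMod p)).2 fun n hn => ?_
    simp only [T, HahnSeries.coeff_sum]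
    refine Finset.sum_eq_zero fun j _ => HahnSeries.coeff_single_of_ne ?_
    omega
  have hL : Valued.v ((polyToLaurent q)⁻¹ * T) ≤ WithZero.exp (-(1 : ℤ)) := by
    rw [map_mul, map_inv₀]
    exact (mul_le_of_le_one_left' (inv_le_one_of_one_le₀ (one_le_valuation_polyToLaurent hq))).trans
      hT
  refine ⟨⟨(polyToLaurent q)⁻¹ * T, fun n hn =>
    (LaurentSeries.valuation_le_iff_coeff_lt_eq_zero (ZMod p)).1 hL n (by omega)⟩, ?_⟩
  ext j
  simp only [coeffWindow, AddMonoidHom.coe_mk, ZeroHom.coe_mk]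
  rw [mul_inv_cancel_left₀ hq0]
  simp only [T, HahnSeries.coeff_sum]
  rw [Finset.sum_eq_single j]
  · simp
  · intro b _ hb
    refine HahnSeries.coeff_single_of_ne fun h => hb (Fin.ext ?_)
    omega
  · simp

theorem isOpen_coeff_mul_eq (q : (ZMod p)[X]) (k : ℤ) (c : ZMod p) :
    IsOpen {L : fracSeries p | (polyToLaurent q * (L : (ZMod p)⸨X⸩)).coeff k = c} := by
  let _ : UniformSpace (ZMod p) := ⊥
  have h1 : Continuous fun L : fracSeries p => polyToLaurent q * (L : (ZMod p)⸨X⸩) :=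
    continuous_const.mul continuous_subtype_val
  have h2 : Continuous fun f : (ZMod p)⸨X⸩ => f.coeff k :=
    (LaurentSeries.uniformContinuous_coeff k).continuous
  exact (isOpen_discrete {c}).preimage (h2.comp h1)

theorem measurableSet_coeffWindow (q : (ZMod p)[X]) (i m : ℕ) (S : Set (Fin m → ZMod p)) :
    MeasurableSet (coeffWindow q i m ⁻¹' S) := by
  have h : coeffWindow q i m ⁻¹' S = ⋃ c ∈ S, ⋂ j : Fin m,
      {L : fracSeries p | (polyToLaurent q * (L : (ZMod p)⸨X⸩)).coeff ((i + j : ℕ) + 1 : ℤ) = c j} := by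
    ext L
    simp only [Set.mem_preimage, Set.mem_iUnion, Set.mem_iInter, Set.mem_ofPred_eq, exists_prop]
    constructor
    · intro hL
      exact ⟨_, hL, fun j => rfl⟩
    · rintro ⟨c, hc, h⟩
      rwa [show coeffWindow q i m L = c from funext h]
  rw [h]
  exact MeasurableSet.biUnion S.to_countable fun c _ =>
    MeasurableSet.iInter fun j => (isOpen_coeff_mul_eq _ _ _).measurableSet

instance : IsProbabilityMeasure (haar p) :=
  ⟨by rw [haar, ← TopologicalSpace.PositiveCompacts.coe_top]; exact Measure.addHaarMeasure_self⟩

instance : (haar p).IsAddLeftInvariant := by rw [haar]; infer_instance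

/-- The fibres of a surjective homomorphism are translates of each other, so the p^m fibres share
the total mass 1 equally. -/
theorem haar_coeffWindow {q : (ZMod p)[X]} (hq : q ≠ 0) (i m : ℕ) (c : Fin m → ZMod p) :
    haar p (coeffWindow q i m ⁻¹' {c}) = ((p : ENNReal) ^ m)⁻¹ := by
  have h1 : ∀ c', haar p (coeffWindow q i m ⁻¹' {c'}) = haar p (coeffWindow q i m ⁻¹' {c}) := by
    intro c'
    obtain ⟨g, hg⟩ := coeffWindow_surjective hq i m (c - c')
    rw [← measure_preimage_add (haar p) g (coeffWindow q i m ⁻¹' {c})]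
    congr 1
    ext L
    simp only [Set.mem_preimage, Set.mem_singleton_iff, map_add, hg]
    constructor
    · intro h; rw [h, sub_add_cancel]
    · intro h
      have := congrArg (fun x => x - (c - c')) h
      simpa using this
  have h2 : ∑ c', haar p (coeffWindow q i m ⁻¹' {c'}) = 1 := by
    rw [sum_measure_preimage_singleton _ fun c' _ => measurableSet_coeffWindow q i m {c'}]
    simp
  rw [Finset.sum_congr rfl fun c' _ => h1 c', Finset.sum_const, Finset.card_univ,
    Fintype.card_fun, ZMod.card, Fintype.card_fin, nsmul_eq_mul, mul_comm] at h2
  rw [← one_div]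
  refine (ENNReal.eq_div_iff ?_ ?_).2 ?_
  · exact pow_ne_zero _ (Nat.cast_ne_zero.2 hp.out.ne_zero)
  · exact ENNReal.pow_ne_top (ENNReal.natCast_ne_top p)
  · rw [mul_comm]
    exact_mod_cast h2

/-- The coefficient -1 is the digit p - 1. For fixed n ≠ 0 and k, having only such digits from k on
forces m prescribed coefficients for every m, an event of probability at most p^(-m). -/
theorem ae_forall_exists_coeff_ne :
    ∀ᵐ L : fracSeries p ∂haar p, ∀ n k : ℕ, ∃ i ≥ k,
      (polyToLaurent (natPoly p n) * (L : (ZMod p)⸨X⸩)).coeff ((i : ℤ) + 1) ≠ -1 := by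
  rw [ae_all_iff]
  intro n
  rw [ae_all_iff]
  intro k
  rcases eq_or_ne n 0 with rfl | hn
  · refine Filter.Eventually.of_forall fun L => ⟨k, le_rfl, ?_⟩
    rw [natPoly_zero, map_zero, zero_mul, HahnSeries.coeff_zero]
    exact (neg_ne_zero.2 one_ne_zero).symm
  · rw [ae_iff]
    refine le_antisymm ?_ zero_le
    have h : ∀ m : ℕ, haar p {L : fracSeries p | ¬ ∃ i ≥ k,
        (polyToLaurent (natPoly p n) * (L : (ZMod p)⸨X⸩)).coeff ((i : ℤ) + 1) ≠ -1} ≤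
        ((p : ENNReal)⁻¹) ^ m := by
      intro m
      rw [← ENNReal.inv_pow, ← haar_coeffWindow (natPoly_ne_zero hn) k m fun _ => -1]
      refine measure_mono fun L hL => ?_
      rw [Set.mem_preimage, Set.mem_singleton_iff]
      ext j
      by_contra hj
      exact hL ⟨k + j, Nat.le_add_right _ _, hj⟩
    refine ge_of_tendsto' (ENNReal.tendsto_pow_atTop_nhds_zero_of_lt_one ?_) h
    rw [ENNReal.inv_lt_one]
    exact_mod_cast hp.out.one_lt

end Haar

section Arithmetic

variable {p : ℕ} [hp : Fact p.Prime]

/-! ### Residue classes and the van der Corput sequences -/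

theorem modByMonic_mem_degreeLT {b : (ZMod p)[X]} (hb : b.Monic) (f : (ZMod p)[X]) :
    f %ₘ b ∈ degreeLT (ZMod p) b.natDegree := by
  rw [mem_degreeLT, ← degree_eq_natDegree hb.ne_zero]
  exact degree_modByMonic_lt f hb

theorem baseDigit_eq_zero {b : (ZMod p)[X]} (hb : b.Monic) (hb0 : 0 < b.natDegree)
    (f : (ZMod p)[X]) {i : ℕ} (hi : f.natDegree < i) : baseDigit b f i = 0 := by
  rw [baseDigit, (divByMonic_eq_zero_iff (hb.pow i)).2, zero_modByMonic]
  rw [degree_eq_natDegree (hb.pow i).ne_zero, hb.natDegree_pow]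
  refine (degree_le_natDegree).trans_lt ?_
  have : i ≤ i * b.natDegree := Nat.le_mul_of_pos_right i hb0
  exact_mod_cast hi.trans_le this

theorem vanDerCorput_digits {b : (ZMod p)[X]} (hb : b.Monic) (hb0 : 0 < b.natDegree) (n : ℕ) :
    0 ≤ vanDerCorput b n ∧ vanDerCorput b n < 1 ∧
      ∀ k, ⌊((p ^ b.natDegree : ℕ) : ℝ) ^ k * vanDerCorput b n⌋₊ =
        digitPrefix (p ^ b.natDegree) (fun i => evalAtP p (baseDigit b (natPoly p n) i)) k := by
  refine floor_digitSum (fun i => evalAtP p (baseDigit b (natPoly p n) i))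
    (fun i => evalAtP_lt (modByMonic_mem_degreeLT hb _)) (fun k => ?_) _ ?_
  · refine ⟨k + (natPoly p n).natDegree + 1, by omega, ?_⟩
    rw [baseDigit_eq_zero hb hb0 _ (by omega), evalAtP_zero]
    have : 1 < p ^ b.natDegree := Nat.one_lt_pow hb0.ne' hp.out.one_lt
    omega
  · rw [vanDerCorput]
    refine tsum_congr fun i => ?_
    push_cast
    rw [pow_mul]

theorem divByMonic_of_dvd_sub {b f g : (ZMod p)[X]} (hb : b.Monic) (h : b ∣ f - g) :
    f - g = b * (f /ₘ b - g /ₘ b) := by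
  have h1 : f %ₘ b = g %ₘ b := by
    rw [← sub_eq_zero, ← sub_modByMonic]
    exact (modByMonic_eq_zero_iff_dvd hb).2 h
  have hf := modByMonic_add_div f b
  have hg := modByMonic_add_div g b
  rw [mul_sub]
  linear_combination -hf + hg + h1

/-- The k lowest digits in base b are equivalent to the residue modulo b^k. Since the van der Corput
map puts low digits first, elementary intervals become residue classes. -/
theorem exists_residue_of_baseDigits {b : (ZMod p)[X]} (hb : b.Monic) (γ : ℕ → ℕ)
    (hγ : ∀ i, γ i < p ^ b.natDegree) (k : ℕ) :
    ∃ R : (ZMod p)[X], ∀ f, (∀ i < k, evalAtP p (baseDigit b f i) = γ i) ↔ b ^ k ∣ f - R := by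
  induction k with
  | zero => exact ⟨0, fun f => by simp⟩
  | succ k ih =>
    obtain ⟨R', hR'⟩ := ih
    have hbk := hb.pow k
    -- The quotient of R' by b^k is replaced by the prescribed digit, leaving the residue modulo b^k
    -- unchanged.
    refine ⟨R' + b ^ k * (natPoly p (γ k) - R' /ₘ b ^ k), fun f => ?_⟩
    rw [Nat.forall_lt_succ_right, hR']
    have h1 : evalAtP p (baseDigit b f k) = γ k ↔ b ∣ f /ₘ b ^ k - natPoly p (γ k) := by
      have hself : natPoly p (γ k) %ₘ b = natPoly p (γ k) := by
        rw [modByMonic_eq_self_iff hb, degree_eq_natDegree hb.ne_zero]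
        exact mem_degreeLT.1 (natPoly_mem_degreeLT (hγ k))
      rw [← modByMonic_eq_zero_iff_dvd hb, sub_modByMonic, hself, sub_eq_zero]
      constructor
      · intro h
        rw [← h, natPoly_evalAtP]
        rfl
      · intro h
        rw [baseDigit, h, evalAtP_natPoly]
    rw [h1]
    have h2 : b ^ k ∣ f - R' → f - (R' + b ^ k * (natPoly p (γ k) - R' /ₘ b ^ k)) =
        b ^ k * (f /ₘ b ^ k - natPoly p (γ k)) := fun h => by
      linear_combination divByMonic_of_dvd_sub hbk h
    constructor
    · rintro ⟨h, h'⟩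
      rw [h2 h, pow_succ]
      exact mul_dvd_mul_left _ h'
    · intro h
      have h3 : b ^ k ∣ f - R' := by
        have h4 : f - R' = (f - (R' + b ^ k * (natPoly p (γ k) - R' /ₘ b ^ k))) +
          b ^ k * (natPoly p (γ k) - R' /ₘ b ^ k) := by ring
        rw [h4]
        exact dvd_add ((pow_dvd_pow b (Nat.le_succ k)).trans h) (dvd_mul_right _ _)
      refine ⟨h3, ?_⟩
      rw [h2 h3, pow_succ] at h
      exact (mul_dvd_mul_iff_left hbk.ne_zero).1 h

theorem exists_residue_vanDerCorput {b : (ZMod p)[X]} (hb : b.Monic) (hb0 : 0 < b.natDegree)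
    (k c : ℕ) (hc : c < (p ^ b.natDegree) ^ k) :
    ∃ R : (ZMod p)[X], ∀ n, ⌊((p ^ b.natDegree : ℕ) : ℝ) ^ k * vanDerCorput b n⌋₊ = c ↔
      b ^ k ∣ natPoly p n - R := by
  obtain ⟨R, hR⟩ := exists_residue_of_baseDigits hb
    (fun i => c / (p ^ b.natDegree) ^ (k - 1 - i) % p ^ b.natDegree)
    (fun i => Nat.mod_lt _ (pow_pos hp.out.pos _)) k
  refine ⟨R, fun n => ?_⟩
  rw [(vanDerCorput_digits hb hb0 n).2.2, ← hR]
  exact digitPrefix_eq_iff (fun i => evalAtP_lt (modByMonic_mem_degreeLT hb _)) k c hc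

theorem exists_residue_halton {t : ℕ} {b : Fin t → (ZMod p)[X]} (hb : ∀ j, (b j).Monic)
    (hb0 : ∀ j, 0 < (b j).natDegree) (hcop : Pairwise fun i j => IsCoprime (b i) (b j))
    (κ c : Fin t → ℕ) (hc : ∀ j, c j < (p ^ (b j).natDegree) ^ κ j) :
    ∃ R : (ZMod p)[X], ∀ n,
      (∀ j, ⌊((p ^ (b j).natDegree : ℕ) : ℝ) ^ κ j * halton b n j⌋₊ = c j) ↔
        ∏ j, b j ^ κ j ∣ natPoly p n - R := by
  choose R hR using fun j => exists_residue_vanDerCorput (hb j) (hb0 j) (κ j) (c j) (hc j)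
  have hcop' : Pairwise fun i j => IsCoprime (b i ^ κ i) (b j ^ κ j) :=
    fun i j hij => (hcop hij).pow
  -- Chinese remainder theorem: this is where pairwise coprimality enters.
  obtain ⟨S, hS⟩ := Ideal.exists_forall_sub_mem_ideal
    (I := fun j => Ideal.span {b j ^ κ j})
    (fun i j hij => Ideal.isCoprime_span_singleton_iff _ _ |>.2 (hcop' hij)) R
  refine ⟨S, fun n => ?_⟩
  have h1 : ∏ j, b j ^ κ j ∣ natPoly p n - S ↔ ∀ j, b j ^ κ j ∣ natPoly p n - S :=
    ⟨fun h j => (Finset.dvd_prod_of_mem (fun j => b j ^ κ j) (Finset.mem_univ j)).trans h,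
      fun h => Fintype.prod_dvd_of_coprime hcop' h⟩
  rw [h1]
  refine forall_congr' fun j => ?_
  have h2 : b j ^ κ j ∣ S - R j := Ideal.mem_span_singleton.1 (hS j)
  rw [halton, hR j n, ← sub_add_sub_cancel (natPoly p n) S (R j)]
  exact dvd_add_left h2

/-! ### The Kronecker sequence -/

/-- The condition that no `{n(X) L}` has an expansion ending in a string of digits `p - 1`. -/
def NoTrailingMax (L : fracSeries p) : Prop :=
  ∀ n k : ℕ, ∃ i ≥ k, (polyToLaurent (natPoly p n) * (L : (ZMod p)⸨X⸩)).coeff ((i : ℤ) + 1) ≠ -1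

theorem kronecker_digits {L : fracSeries p} (hL : NoTrailingMax L) (n : ℕ) :
    0 ≤ kronecker (L : (ZMod p)⸨X⸩) n ∧ kronecker (L : (ZMod p)⸨X⸩) n < 1 ∧
      ∀ m, ⌊(p : ℝ) ^ m * kronecker (L : (ZMod p)⸨X⸩) n⌋₊ = digitPrefix p (fun i =>
        ((polyToLaurent (natPoly p n) * (L : (ZMod p)⸨X⸩)).coeff ((i : ℤ) + 1)).val) m := by
  refine floor_digitSum _ (fun i => ZMod.val_lt _) (fun k => ?_) _ ?_
  · obtain ⟨i, hik, hi⟩ := hL n k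
    refine ⟨i, hik, fun h => hi ?_⟩
    rw [← ZMod.natCast_zmod_val ((polyToLaurent (natPoly p n) * (L : (ZMod p)⸨X⸩)).coeff _), h,
      Nat.cast_sub hp.out.one_le]
    simp
  · rw [kronecker, evalFrac]
    refine tsum_congr fun i => ?_
    simp [fracPart]

theorem exists_window_kronecker {L : fracSeries p} (hL : NoTrailingMax L) (m c : ℕ)
    (hc : c < p ^ m) :
    ∃ γ : Fin m → ZMod p, ∀ n, ⌊(p : ℝ) ^ m * kronecker (L : (ZMod p)⸨X⸩) n⌋₊ = c ↔
      coeffWindow (natPoly p n) 0 m L = γ := by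
  refine ⟨fun j => ((c / p ^ (m - 1 - j) % p : ℕ) : ZMod p), fun n => ?_⟩
  rw [(kronecker_digits hL n).2.2]
  refine (digitPrefix_eq_iff (fun i => ZMod.val_lt _) m c hc).trans ?_
  rw [funext_iff, Fin.forall_iff]
  refine forall₂_congr fun i hi => ?_
  have h1 : coeffWindow (natPoly p n) 0 m L ⟨i, hi⟩ =
      (polyToLaurent (natPoly p n) * (L : (ZMod p)⸨X⸩)).coeff ((i : ℤ) + 1) := by
    simp [coeffWindow]
  rw [h1]
  constructor
  · intro h
    rw [← h, ZMod.natCast_zmod_val]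
  · intro h
    rw [h, ZMod.val_natCast, Nat.mod_mod]

/-! ### Fibres of the digit map on a residue class -/

noncomputable instance (s : ℕ) : Fintype (degreeLT (ZMod p) s) :=
  Fintype.ofEquiv _ (degreeLTEquiv (ZMod p) s).symm.toEquiv

theorem card_degreeLT (s : ℕ) : Fintype.card (degreeLT (ZMod p) s) = p ^ s := by
  rw [Fintype.card_congr (degreeLTEquiv (ZMod p) s).toEquiv, Fintype.card_fun, ZMod.card,
    Fintype.card_fin]

theorem coeffWindow_add (q q' : (ZMod p)[X]) (i m : ℕ) (L : fracSeries p) :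
    coeffWindow (q + q') i m L = coeffWindow q i m L + coeffWindow q' i m L := by
  ext j
  simp [coeffWindow, add_mul]

/-- The map sending a polynomial `h` of degree less than `s` to the first `m` coefficients of the
fractional part of `h q L`. -/
noncomputable def windowHom (q : (ZMod p)[X]) (s m : ℕ) (L : fracSeries p) :
    degreeLT (ZMod p) s →+ (Fin m → ZMod p) where
  toFun h := coeffWindow (q * (h : (ZMod p)[X])) 0 m L
  map_zero' := by ext; simp [coeffWindow]
  map_add' h h' := by rw [Submodule.coe_add, mul_add, coeffWindow_add]

open Classical in
/-- The defect of equidistribution of `windowHom`: zero if it is surjective, and the size of its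
kernel otherwise. -/
noncomputable def defect (q : (ZMod p)[X]) (s m : ℕ) (L : fracSeries p) : ℕ :=
  if Function.Surjective (windowHom q s m L) then 0 else Nat.card (windowHom q s m L).ker

theorem card_fiber_le {G H : Type*} [AddCommGroup G] [Fintype G] [AddCommGroup H] [DecidableEq H]
    (φ : G →+ H) (c : H) : (Finset.univ.filter fun g => φ g = c).card ≤ Nat.card φ.ker := by
  classical
  rcases (Finset.univ.filter fun g => φ g = c).eq_empty_or_nonempty with h | ⟨g₀, hg₀⟩
  · rw [h]; simp
  · rw [Nat.card_eq_fintype_card, ← Finset.card_univ]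
    have hg₀' : φ g₀ = c := (Finset.mem_filter.1 hg₀).2
    refine Finset.card_le_card_of_surjOn (fun k : φ.ker => g₀ + k) fun g hg => ?_
    have hg' : φ g = c := by simpa using hg
    refine ⟨⟨g - g₀, ?_⟩, by simp, by simp⟩
    rw [AddMonoidHom.mem_ker, map_sub, hg', hg₀', sub_self]

theorem card_ker_mul_card_range {G H : Type*} [AddCommGroup G] [Fintype G] [AddCommGroup H]
    (φ : G →+ H) : Nat.card φ.ker * Nat.card φ.range = Fintype.card G := by
  rw [← Nat.card_eq_fintype_card, ← AddSubgroup.card_mul_index φ.ker, AddSubgroup.index_ker]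

theorem card_fiber_of_surjective {G H : Type*} [AddCommGroup G] [Fintype G] [AddCommGroup H]
    [Fintype H] [DecidableEq H] (φ : G →+ H) (hφ : Function.Surjective φ) (c : H) :
    (Finset.univ.filter fun g => φ g = c).card * Fintype.card H = Fintype.card G := by
  have h1 : ∀ c', (Finset.univ.filter fun g => φ g = c').card =
      (Finset.univ.filter fun g => φ g = c).card := by
    intro c'
    obtain ⟨k, hk⟩ := hφ (c - c')
    refine Finset.card_bij (fun g _ => g + k) (fun g hg => ?_) (fun _ _ _ _ h => add_right_cancel h)
      fun g hg => ⟨g - k, ?_, by simp⟩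
    · have : φ g = c' := by simpa using hg
      simp [this, hk]
    · have : φ g = c := by simpa using hg
      simp [this, hk]
  have h2 : Fintype.card G = ∑ c' : H, (Finset.univ.filter fun g => φ g = c').card := by
    rw [← Finset.card_univ]
    exact Finset.card_eq_sum_card_fiberwise fun _ _ => Finset.mem_univ _
  rw [h2, Finset.sum_congr rfl fun c' _ => h1 c', Finset.sum_const, Finset.card_univ, smul_eq_mul,
    mul_comm]

/-- In the surjective case all fibres have the expected size. Otherwise both the fibre size and the
expected size p^(s-m) lie between 0 and the size of the kernel. -/
theorem abs_card_fiber_sub_le (q : (ZMod p)[X]) (s m : ℕ) (L : fracSeries p) (c : Fin m → ZMod p) :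
    |((Finset.univ.filter fun h => windowHom q s m L h = c).card : ℝ) -
      (p : ℝ) ^ s * ((p : ℝ) ^ m)⁻¹| ≤ defect q s m L := by
  have hp0 : (0 : ℝ) < (p : ℝ) ^ m := pow_pos (Nat.cast_pos.2 hp.out.pos) m
  have hcard : Fintype.card (Fin m → ZMod p) = p ^ m := by
    rw [Fintype.card_fun, ZMod.card, Fintype.card_fin]
  by_cases hs : Function.Surjective (windowHom q s m L)
  · have h := card_fiber_of_surjective _ hs c
    rw [card_degreeLT, hcard] at h
    rw [← Nat.cast_pow p s, ← h]
    push_cast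
    rw [mul_inv_cancel_right₀ hp0.ne', sub_self, abs_zero]
    exact Nat.cast_nonneg _
  · rw [defect, if_neg hs]
    have h1 : ((Finset.univ.filter fun h => windowHom q s m L h = c).card : ℝ) ≤
        Nat.card (windowHom q s m L).ker := by exact_mod_cast card_fiber_le _ c
    have h2 : (p : ℝ) ^ s * ((p : ℝ) ^ m)⁻¹ ≤ Nat.card (windowHom q s m L).ker := by
      rw [← div_eq_mul_inv, div_le_iff₀ hp0, ← Nat.cast_pow p s, ← card_degreeLT (p := p) s,
        ← card_ker_mul_card_range (windowHom q s m L)]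
      push_cast
      have h3 : Nat.card (windowHom q s m L).range ≤ p ^ m := by
        rw [← hcard, ← Nat.card_eq_fintype_card]
        exact Nat.card_le_card_of_injective _ Subtype.val_injective
      have h4 : (Nat.card (windowHom q s m L).range : ℝ) ≤ (p : ℝ) ^ m := by exact_mod_cast h3
      gcongr
    have h5 : 0 ≤ (p : ℝ) ^ s * ((p : ℝ) ^ m)⁻¹ := by positivity
    rw [abs_le]
    constructor
    · linarith [Nat.cast_nonneg (α := ℝ)
        (Finset.univ.filter fun h => windowHom q s m L h = c).card]
    · linarith

/-- The local discrepancy of `[0, v)` for the points of the Kronecker sequence whose indices form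
a residue class. -/
theorem kronecker_error_le {L : fracSeries p} (hL : NoTrailingMax L) (F q : (ZMod p)[X]) (s : ℕ)
    {v : ℝ} (hv : 0 ≤ v) (hv1 : v ≤ 1) :
    |((Finset.univ.filter fun h : degreeLT (ZMod p) s =>
        kronecker (L : (ZMod p)⸨X⸩) (evalAtP p (F + q * h)) < v).card : ℝ) - (p : ℝ) ^ s * v| ≤
      2 + (p + 1) * ((∑ m ∈ Finset.range (s + 1), defect q s m L : ℕ) : ℝ) := by
  have hp0 : (0 : ℝ) < (p : ℝ) := Nat.cast_pos.2 hp.out.pos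
  have hE : ∀ m ≤ s, ∀ c < p ^ m, |((Finset.univ.filter fun h : degreeLT (ZMod p) s =>
      ⌊(p : ℝ) ^ m * kronecker (L : (ZMod p)⸨X⸩) (evalAtP p (F + q * h))⌋₊ = c).card : ℝ) -
        (p : ℝ) ^ s * ((p : ℝ) ^ m)⁻¹| ≤ (defect q s m L : ℝ) := by
    intro m _ c hc
    obtain ⟨γ, hγ⟩ := exists_window_kronecker hL m c hc
    -- Since (F + q h) L = F L + h q L, prescribing m digits is an affine condition on h.
    have h1 : ∀ h : degreeLT (ZMod p) s,
        ⌊(p : ℝ) ^ m * kronecker (L : (ZMod p)⸨X⸩) (evalAtP p (F + q * h))⌋₊ = c ↔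
          windowHom q s m L h = γ - coeffWindow F 0 m L := by
      intro h
      rw [hγ, natPoly_evalAtP, coeffWindow_add, eq_sub_iff_add_eq, add_comm]
      rfl
    rw [Finset.filter_congr fun h _ => h1 h]
    exact abs_card_fiber_sub_le q s m L _
  have hmain := interval_error_le Finset.univ
    (fun h : degreeLT (ZMod p) s => kronecker (L : (ZMod p)⸨X⸩) (evalAtP p (F + q * h)))
    (fun h _ => (kronecker_digits hL _).1) hv hv1 hp.out.pos s ((p : ℝ) ^ s) (by positivity)
    (fun m => defect q s m L) hE
  refine hmain.trans ?_
  have hone : (p : ℝ) ^ s * ((p : ℝ) ^ s)⁻¹ = 1 := mul_inv_cancel₀ (by positivity)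
  have hlast : ((Finset.univ.filter fun h : degreeLT (ZMod p) s =>
      ⌊(p : ℝ) ^ s * kronecker (L : (ZMod p)⸨X⸩) (evalAtP p (F + q * h))⌋₊ =
        ⌊(p : ℝ) ^ s * v⌋₊).card : ℝ) ≤ 1 + defect q s s L := by
    rcases lt_or_ge ⌊(p : ℝ) ^ s * v⌋₊ (p ^ s) with h | h
    · have := hE s le_rfl _ h
      rw [hone] at this
      linarith [(abs_le.1 this).2]
    -- This case arises for v = 1, and no point lies beyond the last interval.
    · rw [Finset.filter_false_of_mem]
      · simp only [Finset.card_empty, Nat.cast_zero]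
        positivity
      · intro g _ hg
        have h2 : ⌊(p : ℝ) ^ s * kronecker (L : (ZMod p)⸨X⸩) (evalAtP p (F + q * g))⌋₊ < p ^ s := by
          rw [Nat.floor_lt (mul_nonneg (by positivity) (kronecker_digits hL _).1)]
          push_cast
          exact mul_lt_of_lt_one_right (by positivity) (kronecker_digits hL _).2.1
        omega
  have hle : (defect q s s L : ℝ) ≤ ((∑ m ∈ Finset.range (s + 1), defect q s m L : ℕ) : ℝ) := by
    exact_mod_cast Finset.single_le_sum (f := fun m => defect q s m L)
      (fun _ _ => Nat.zero_le _) (Finset.self_mem_range_succ s)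
  rw [hone, ← Finset.mul_sum]
  push_cast at hle ⊢
  linarith

end Arithmetic

section Blocks

variable {p : ℕ} [hp : Fact p.Prime]

/-! ### The local discrepancy of a block -/

theorem mem_Ico_block_iff (a r n : ℕ) :
    n ∈ Finset.Ico (a * p ^ r) ((a + 1) * p ^ r) ↔
      natPoly p n - X ^ r * natPoly p a ∈ degreeLT (ZMod p) r := by
  rw [← natPoly_block, Finset.mem_Ico, Nat.div_eq_iff (pow_pos hp.out.pos r),
    add_mul, one_mul]
  have := pow_pos hp.out.pos r
  omega

theorem mul_mem_degreeLT_iff {B : (ZMod p)[X]} (hB : B.Monic) (h : (ZMod p)[X]) (s : ℕ) :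
    B * h ∈ degreeLT (ZMod p) (B.natDegree + s) ↔ h ∈ degreeLT (ZMod p) s := by
  rcases eq_or_ne h 0 with rfl | h0
  · simp
  · rw [mem_degreeLT, mem_degreeLT, ← natDegree_lt_iff_degree_lt (mul_ne_zero hB.ne_zero h0),
      ← natDegree_lt_iff_degree_lt h0, natDegree_mul hB.ne_zero h0]
    omega

/-- Two such n(X) would differ by a multiple of B of degree less than r ≤ deg B. -/
theorem card_residue_le_one {B : (ZMod p)[X]} (hB : B.Monic) (R : (ZMod p)[X]) (a r : ℕ)
    (hr : r ≤ B.natDegree) (Q : ℕ → Prop) [DecidablePred Q]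
    (hQ : ∀ n, Q n → B ∣ natPoly p n - R) :
    ((Finset.Ico (a * p ^ r) ((a + 1) * p ^ r)).filter Q).card ≤ 1 := by
  rw [Finset.card_le_one]
  intro n hn n' hn'
  rw [Finset.mem_filter, mem_Ico_block_iff] at hn hn'
  refine natPoly_injective (p := p) (sub_eq_zero.1 ?_)
  have h1 := (degreeLT (ZMod p) r).sub_mem hn.1 hn'.1
  rw [sub_sub_sub_cancel_right, mem_degreeLT] at h1
  have h2 := dvd_sub (hQ _ hn.2) (hQ _ hn'.2)
  rw [sub_sub_sub_cancel_right] at h2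
  refine eq_zero_of_dvd_of_degree_lt h2 (h1.trans_le ?_)
  rw [degree_eq_natDegree hB.ne_zero]
  exact_mod_cast hr

theorem card_residue_block {B : (ZMod p)[X]} (hB : B.Monic) (R : (ZMod p)[X]) (a r : ℕ)
    (hr : B.natDegree ≤ r) : ∃ F : (ZMod p)[X], ∀ (Q Q' : ℕ → Prop) [DecidablePred Q]
    [DecidablePred Q'], (∀ n, Q n ↔ B ∣ natPoly p n - R) →
    (((Finset.Ico (a * p ^ r) ((a + 1) * p ^ r)).filter Q).filter Q').card =
      (Finset.univ.filter fun h : degreeLT (ZMod p) (r - B.natDegree) =>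
        Q' (evalAtP p (F + B * h))).card := by
  set A := X ^ r * natPoly p a with hA
  have hFA : (R - A) %ₘ B ∈ degreeLT (ZMod p) r :=
    degreeLT_mono hr (modByMonic_mem_degreeLT hB _)
  have hFR : B ∣ A + (R - A) %ₘ B - R := by
    have h := modByMonic_add_div (R - A) B
    exact ⟨-((R - A) /ₘ B), by linear_combination h⟩
  have hmul : ∀ h : (ZMod p)[X], B * h ∈ degreeLT (ZMod p) r ↔
      h ∈ degreeLT (ZMod p) (r - B.natDegree) := fun h => by
    rw [← mul_mem_degreeLT_iff hB h, Nat.add_sub_cancel' hr]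
  -- This F is congruent to R modulo B and differs from X^r a(X) by degree less than deg B ≤ r, so
  -- it belongs to the block as well.
  refine ⟨A + (R - A) %ₘ B, fun Q Q' _ _ hQ => ?_⟩
  symm
  refine Finset.card_bij (fun h _ => evalAtP p (A + (R - A) %ₘ B + B * h)) ?_ ?_ ?_
  · intro h hh
    rw [Finset.mem_filter, Finset.mem_filter, mem_Ico_block_iff, hQ, natPoly_evalAtP]
    refine ⟨⟨?_, ?_⟩, (Finset.mem_filter.1 hh).2⟩
    · rw [← hA, show A + (R - A) %ₘ B + B * h - A = (R - A) %ₘ B + B * h by ring]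
      exact Submodule.add_mem _ hFA ((hmul _).2 h.2)
    · rw [show A + (R - A) %ₘ B + B * h - R = (A + (R - A) %ₘ B - R) + B * h by ring]
      exact dvd_add hFR (dvd_mul_right _ _)
  · intro h _ h' _ heq
    have h1 := congrArg (natPoly p) heq
    simp only [natPoly_evalAtP, add_right_inj] at h1
    exact Subtype.ext (mul_left_cancel₀ hB.ne_zero h1)
  · intro n hn
    rw [Finset.mem_filter, Finset.mem_filter, mem_Ico_block_iff, hQ] at hn
    obtain ⟨⟨h1, h2⟩, h3⟩ := hn
    obtain ⟨h, hh⟩ := dvd_sub h2 hFR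
    have hh' : natPoly p n = A + (R - A) %ₘ B + B * h := by linear_combination hh
    have hmem : B * h ∈ degreeLT (ZMod p) r := by
      rw [show B * h = (natPoly p n - A) - (R - A) %ₘ B by linear_combination -hh']
      exact Submodule.sub_mem _ h1 hFA
    have hn' : evalAtP p (A + (R - A) %ₘ B + B * h) = n := by rw [← hh', evalAtP_natPoly]
    refine ⟨⟨h, (hmul h).1 hmem⟩, ?_, hn'⟩
    rw [Finset.mem_filter]
    refine ⟨Finset.mem_univ _, ?_⟩
    simp only
    rwa [hn']

/-- The total defect of the points of a block of length `p ^ r` lying in a residue class modulo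
`B`. -/
noncomputable def classDefect (B : (ZMod p)[X]) (r : ℕ) (L : fracSeries p) : ℕ :=
  if B.natDegree ≤ r then
    ∑ m ∈ Finset.range (r - B.natDegree + 1), defect B (r - B.natDegree) m L
  else 0

/-- If deg B > r, both the count and its expected value lie in [0, 1], so no defect needs to be
charged. -/
theorem class_error_le {L : fracSeries p} (hL : NoTrailingMax L) {B : (ZMod p)[X]} (hB : B.Monic)
    (R : (ZMod p)[X]) (a r : ℕ) {v : ℝ} (hv : 0 ≤ v) (hv1 : v ≤ 1) (Q : ℕ → Prop)
    [DecidablePred Q] (hQ : ∀ n, Q n ↔ B ∣ natPoly p n - R) :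
    |∑ n ∈ (Finset.Ico (a * p ^ r) ((a + 1) * p ^ r)).filter Q,
        (if kronecker (L : (ZMod p)⸨X⸩) n < v then (1 : ℝ) else 0) -
      (p : ℝ) ^ r * v * ((p : ℝ) ^ B.natDegree)⁻¹| ≤ 2 + (p + 1) * (classDefect B r L : ℝ) := by
  have hp0 : (0 : ℝ) < (p : ℝ) := Nat.cast_pos.2 hp.out.pos
  have hp1 : (1 : ℝ) ≤ (p : ℝ) := Nat.one_le_cast.2 hp.out.one_le
  rw [Finset.sum_boole]
  rcases le_or_gt B.natDegree r with hr | hr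
  · obtain ⟨F, hF⟩ := card_residue_block hB R a r hr
    rw [hF Q _ hQ, classDefect, if_pos hr]
    have h1 : (p : ℝ) ^ r * v * ((p : ℝ) ^ B.natDegree)⁻¹ = (p : ℝ) ^ (r - B.natDegree) * v := by
      rw [pow_sub₀ _ hp0.ne' hr]; ring
    rw [h1]
    exact kronecker_error_le hL F B _ hv hv1
  · rw [classDefect, if_neg (not_le.2 hr)]
    have h1 : ((((Finset.Ico (a * p ^ r) ((a + 1) * p ^ r)).filter Q).filter fun n =>
        kronecker (L : (ZMod p)⸨X⸩) n < v).card : ℝ) ≤ 1 := by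
      exact_mod_cast (Finset.card_le_card (Finset.filter_subset _ _)).trans
        (card_residue_le_one hB R a r hr.le Q fun n hn => (hQ n).1 hn)
    have h2 : (p : ℝ) ^ r * v * ((p : ℝ) ^ B.natDegree)⁻¹ ≤ 1 := by
      rw [← div_eq_mul_inv, div_le_one (by positivity)]
      exact (mul_le_of_le_one_right (by positivity) hv1).trans (pow_le_pow_right₀ hp1 hr.le)
    have h3 : 0 ≤ (p : ℝ) ^ r * v * ((p : ℝ) ^ B.natDegree)⁻¹ := by positivity
    rw [abs_le]
    constructor
    · push_cast
      linarith [Nat.cast_nonneg (α := ℝ) (((Finset.Ico (a * p ^ r) ((a + 1) * p ^ r)).filter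
        Q).filter fun n => kronecker (L : (ZMod p)⸨X⸩) n < v).card]
    · push_cast
      linarith

theorem halton_nonneg {t : ℕ} {b : Fin t → (ZMod p)[X]} (hb : ∀ j, (b j).Monic)
    (hb0 : ∀ j, 0 < (b j).natDegree) (n : ℕ) (j : Fin t) : 0 ≤ halton b n j :=
  (vanDerCorput_digits (hb j) (hb0 j) n).1

theorem prod_pow_natDegree {t : ℕ} {b : Fin t → (ZMod p)[X]} (hb : ∀ j, (b j).Monic)
    (κ : Fin t → ℕ) :
    ∏ j, ((((p ^ (b j).natDegree : ℕ) : ℝ)) ^ κ j)⁻¹ =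
      ((p : ℝ) ^ (∏ j, b j ^ κ j).natDegree)⁻¹ := by
  rw [natDegree_prod_of_monic _ _ fun j _ => (hb j).pow _, Finset.prod_inv_distrib,
    ← Finset.prod_pow_eq_pow_sum]
  congr 1
  refine Finset.prod_congr rfl fun j _ => ?_
  rw [(hb j).natDegree_pow, mul_comm, pow_mul]
  push_cast
  rfl

/-- Level r corresponds to the modulus b_j^r, of degree at least r. This makes the boundary terms
bounded when boxes are resolved to level r. -/
theorem card_halton_interval_le_one {t : ℕ} {b : Fin t → (ZMod p)[X]} (hb : ∀ j, (b j).Monic)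
    (hb0 : ∀ j, 0 < (b j).natDegree) (a r : ℕ) (j : Fin t) (c : ℕ) :
    ((Finset.Ico (a * p ^ r) ((a + 1) * p ^ r)).filter fun n =>
      ⌊((p ^ (b j).natDegree : ℕ) : ℝ) ^ r * halton b n j⌋₊ = c).card ≤ 1 := by
  rcases lt_or_ge c ((p ^ (b j).natDegree) ^ r) with hc | hc
  · obtain ⟨R, hR⟩ := exists_residue_vanDerCorput (hb j) (hb0 j) r c hc
    refine card_residue_le_one ((hb j).pow r) R a r ?_ _ fun n hn => (hR n).1 hn
    rw [(hb j).natDegree_pow]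
    exact Nat.le_mul_of_pos_right r (hb0 j)
  · rw [Finset.filter_false_of_mem]
    · simp
    · intro n _ hn
      have h := vanDerCorput_digits (hb j) (hb0 j) n
      have hQ : (0 : ℝ) < ((p ^ (b j).natDegree : ℕ) : ℝ) ^ r :=
        pow_pos (Nat.cast_pos.2 (pow_pos hp.out.pos _)) _
      have h2 : ⌊((p ^ (b j).natDegree : ℕ) : ℝ) ^ r * halton b n j⌋₊ <
          (p ^ (b j).natDegree) ^ r := by
        rw [halton, Nat.floor_lt (mul_nonneg hQ.le h.1)]
        rw [Nat.cast_pow (p ^ (b j).natDegree) r]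
        exact mul_lt_of_lt_one_right hQ h.2.1
      omega

theorem mul_prod_boole {ι : Type*} [Fintype ι] (x : ℝ) (Q : ι → Prop) [DecidablePred Q]
    [Decidable (∀ j, Q j)] :
    x * (∏ j, if Q j then (1 : ℝ) else 0) = if ∀ j, Q j then x else 0 := by
  rw [Fintype.prod_boole]
  by_cases h : ∀ j, Q j
  · rw [if_pos h, if_pos h, mul_one]
  · rw [if_neg h, if_neg h, mul_zero]

/-- Only the Halton coordinates are cut into elementary intervals here; the Kronecker condition is
carried along as a weight and treated inside each residue class. Each Halton coordinate adds a
boundary error of at most 2. -/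
theorem block_error_le {t : ℕ} {b : Fin t → (ZMod p)[X]} (hb : ∀ j, (b j).Monic)
    (hb0 : ∀ j, 0 < (b j).natDegree) (hcop : Pairwise fun i j => IsCoprime (b i) (b j))
    {L : fracSeries p} (hL : NoTrailingMax L) (a r : ℕ) {v : ℝ} (hv : 0 ≤ v) (hv1 : v ≤ 1)
    {w : Fin t → ℝ} (hw : ∀ j, 0 ≤ w j) (hw1 : ∀ j, w j ≤ 1) :
    |∑ n ∈ Finset.Ico (a * p ^ r) ((a + 1) * p ^ r),
        ((if kronecker (L : (ZMod p)⸨X⸩) n < v then (1 : ℝ) else 0) *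
          (∏ j, if halton b n j < w j then (1 : ℝ) else 0) - v * ∏ j, w j)| ≤
      (∏ j, ((p ^ (b j).natDegree : ℕ) : ℝ)) *
        ∑ κ ∈ Fintype.piFinset fun _ : Fin t => Finset.range (r + 1),
          (2 + (p + 1) * (classDefect (∏ j, b j ^ κ j) r L : ℝ)) + 2 * t := by
  have hp0 : (0 : ℝ) < (p : ℝ) := Nat.cast_pos.2 hp.out.pos
  have hp1 : (1 : ℝ) ≤ (p : ℝ) := Nat.one_le_cast.2 hp.out.one_le
  have h := box_error_le (Finset.Ico (a * p ^ r) ((a + 1) * p ^ r)) (halton b)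
    (fun n _ => halton_nonneg hb hb0 n) hw hw1
    (q := fun j => p ^ (b j).natDegree) (fun j => pow_pos hp.out.pos _) r
    (fun n => if kronecker (L : (ZMod p)⸨X⸩) n < v then (1 : ℝ) else 0)
    (fun n => by split_ifs <;> simp) (fun n => by split_ifs <;> simp)
    ((p : ℝ) ^ r * v) (by positivity)
    (fun κ => 2 + (p + 1) * (classDefect (∏ j, b j ^ κ j) r L : ℝ)) (fun κ _ c hc => by
      obtain ⟨R, hR⟩ := exists_residue_halton hb hb0 hcop κ c hc
      rw [prod_pow_natDegree hb, Finset.sum_congr rfl fun n _ => mul_prod_boole _ _,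
        ← Finset.sum_filter]
      exact class_error_le hL (monic_prod_of_monic _ _ fun j _ => (hb j).pow _) R a r hv hv1 _ hR)
  have hlhs : ∑ n ∈ Finset.Ico (a * p ^ r) ((a + 1) * p ^ r),
        ((if kronecker (L : (ZMod p)⸨X⸩) n < v then (1 : ℝ) else 0) *
          (∏ j, if halton b n j < w j then (1 : ℝ) else 0) - v * ∏ j, w j) =
      ∑ n ∈ Finset.Ico (a * p ^ r) ((a + 1) * p ^ r),
        (if kronecker (L : (ZMod p)⸨X⸩) n < v then (1 : ℝ) else 0) *
          (∏ j, if halton b n j < w j then (1 : ℝ) else 0) - p ^ r * v * ∏ j, w j := by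
    rw [Finset.sum_sub_distrib, Finset.sum_const, Nat.card_Ico, ← Nat.sub_mul,
      Nat.add_sub_cancel_left, one_mul, nsmul_eq_mul, Nat.cast_pow, mul_assoc]
  rw [hlhs]
  refine h.trans ((add_le_add_iff_left _).2 ?_)
  refine (Finset.sum_le_card_nsmul _ _ 2 fun j _ => ?_).trans ?_
  · have h1 : (((Finset.Ico (a * p ^ r) ((a + 1) * p ^ r)).filter fun n =>
      ⌊((p ^ (b j).natDegree : ℕ) : ℝ) ^ r * halton b n j⌋₊ =
        ⌊((p ^ (b j).natDegree : ℕ) : ℝ) ^ r * w j⌋₊).card : ℝ) ≤ 1 := by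
      exact_mod_cast card_halton_interval_le_one hb hb0 a r j _
    have h2 : (p : ℝ) ^ r * v * (((p ^ (b j).natDegree : ℕ) : ℝ) ^ r)⁻¹ ≤ 1 := by
      rw [← div_eq_mul_inv]
      push_cast
      rw [div_le_one (by positivity)]
      refine (mul_le_of_le_one_right (by positivity) hv1).trans ?_
      exact pow_le_pow_left₀ hp0.le (le_self_pow₀ hp1 (hb0 j).ne') r
    linarith
  · rw [Finset.card_univ, Fintype.card_fin, nsmul_eq_mul, mul_comm]

/-- The sum of all defects for blocks of length less than `p ^ R`. -/
noncomputable def totalDefect {t : ℕ} (b : Fin t → (ZMod p)[X]) (R : ℕ) (L : fracSeries p) : ℕ :=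
  ∑ r ∈ Finset.range R, ∑ κ ∈ Fintype.piFinset fun _ : Fin t => Finset.range R,
    classDefect (∏ j, b j ^ κ j) r L

theorem totalDefect_mono {t : ℕ} (b : Fin t → (ZMod p)[X]) (L : fracSeries p) {R R' : ℕ}
    (h : R ≤ R') : totalDefect b R L ≤ totalDefect b R' L := by
  have hR : Finset.range R ⊆ Finset.range R' := Finset.range_subset_range.2 h
  refine (Finset.sum_le_sum fun r _ => ?_).trans (Finset.sum_le_sum_of_subset hR)
  exact Finset.sum_le_sum_of_subset (Fintype.piFinset_subset _ _ fun _ => hR)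

/-- The term R^(t+1) counts the pairs (r, κ), each contributing a bounded error besides its defects.
The constant does not depend on L. -/
theorem discrepancies_kroneckerHalton_le {t : ℕ} {b : Fin t → (ZMod p)[X]}
    (hb : ∀ j, (b j).Monic) (hb0 : ∀ j, 0 < (b j).natDegree)
    (hcop : Pairwise fun i j => IsCoprime (b i) (b j)) :
    ∃ C : ℝ, 0 ≤ C ∧ ∀ L : fracSeries p, NoTrailingMax L → ∀ N R : ℕ, N ≠ 0 → N < p ^ R →
      N * discrepancy (kroneckerHalton (L : (ZMod p)⸨X⸩) b) N ≤
        C * ((R : ℝ) ^ (t + 1) + totalDefect b R L) ∧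
      N * starDiscrepancy (kroneckerHalton (L : (ZMod p)⸨X⸩) b) N ≤
        C * ((R : ℝ) ^ (t + 1) + totalDefect b R L) := by
  set D : ℝ := ∏ j, ((p ^ (b j).natDegree : ℕ) : ℝ) with hD
  have hD0 : 0 ≤ D := Finset.prod_nonneg fun j _ => Nat.cast_nonneg _
  refine ⟨2 ^ (t + 1) * (p * (2 * D + D * (p + 1) + 2 * t)), by positivity,
    fun L hL N R hN hNR => ?_⟩
  have hR : 1 ≤ R := by
    by_contra h
    have : R = 0 := by omega
    subst this
    simp at hNR
    exact hN hNR
  have hRt : (R : ℝ) ≤ (R : ℝ) ^ (t + 1) := le_self_pow₀ (by exact_mod_cast hR) (by omega)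
  rw [mul_assoc]
  refine discrepancies_le _ hN _ fun w hw hw1 => ?_
  have hcons : ∀ n, (∏ j, if kroneckerHalton (L : (ZMod p)⸨X⸩) b n j < w j then (1 : ℝ) else 0) =
      (if kronecker (L : (ZMod p)⸨X⸩) n < w 0 then (1 : ℝ) else 0) *
        ∏ j, if halton b n j < w j.succ then (1 : ℝ) else 0 := by
    intro n
    rw [Fin.prod_univ_succ]
    rfl
  let E : ℕ → ℝ := fun r => D * ∑ κ ∈ Fintype.piFinset fun _ : Fin t => Finset.range (r + 1),
          (2 + (p + 1) * (classDefect (∏ j, b j ^ κ j) r L : ℝ)) + 2 * t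
  have hsum := abs_sum_le_of_blocks (p := p) (fun n =>
    (∏ j, if kroneckerHalton (L : (ZMod p)⸨X⸩) b n j < w j then (1 : ℝ) else 0) - ∏ j, w j)
    E (fun r => by positivity) (fun r a => by
      simp_rw [hcons, Fin.prod_univ_succ w]
      exact block_error_le hb hb0 hcop hL a r (hw 0) (hw1 0) (fun j => hw _) fun j => hw1 _)
    R 0 N hNR
  rw [zero_mul, zero_add, ← Finset.range_eq_Ico] at hsum
  refine hsum.trans ?_
  rw [← Finset.mul_sum, mul_assoc]
  refine mul_le_mul_of_nonneg_left ?_ (Nat.cast_nonneg p)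
  have hE : ∀ r ∈ Finset.range R, E r ≤ 2 * D * (R : ℝ) ^ t + D * (p + 1) *
      ((∑ κ ∈ Fintype.piFinset fun _ : Fin t => Finset.range R,
        classDefect (∏ j, b j ^ κ j) r L : ℕ) : ℝ) + 2 * t := by
    intro r hr
    have hsub : (Fintype.piFinset fun _ : Fin t => Finset.range (r + 1)) ⊆
        Fintype.piFinset fun _ : Fin t => Finset.range R :=
      Fintype.piFinset_subset _ _ fun _ => Finset.range_subset_range.2 (Finset.mem_range.1 hr)
    have h1 := Finset.sum_le_sum_of_subset_of_nonneg hsub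
      (f := fun κ => 2 + (p + 1) * (classDefect (∏ j, b j ^ κ j) r L : ℝ))
      fun κ _ _ => by positivity
    refine (add_le_add (mul_le_mul_of_nonneg_left h1 hD0) le_rfl).trans (le_of_eq ?_)
    rw [Finset.sum_add_distrib, Finset.sum_const, Fintype.card_piFinset, ← Finset.mul_sum]
    simp only [Finset.card_range, Finset.prod_const, Finset.card_univ, Fintype.card_fin,
      nsmul_eq_mul]
    push_cast
    ring
  refine (Finset.sum_le_sum hE).trans ?_
  rw [Finset.sum_add_distrib, Finset.sum_add_distrib, Finset.sum_const, Finset.sum_const,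
    Finset.card_range, nsmul_eq_mul, nsmul_eq_mul, ← Finset.mul_sum]
  have hT : ∑ r ∈ Finset.range R, ((∑ κ ∈ Fintype.piFinset fun _ : Fin t => Finset.range R,
        classDefect (∏ j, b j ^ κ j) r L : ℕ) : ℝ) = totalDefect b R L := by
    rw [totalDefect]
    push_cast
    rfl
  rw [hT]
  have hT0 : (0 : ℝ) ≤ totalDefect b R L := Nat.cast_nonneg _
  have h1 : (R : ℝ) * (2 * D * (R : ℝ) ^ t) = 2 * D * (R : ℝ) ^ (t + 1) := by ring
  rw [h1]
  have h2 : (R : ℝ) * (2 * t) ≤ 2 * t * (R : ℝ) ^ (t + 1) := by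
    rw [mul_comm]
    exact mul_le_mul_of_nonneg_left hRt (by positivity)
  -- Slack terms, so that one constant serves for both R^(t+1) and the total defect.
  have h3 : 0 ≤ (2 * D + 2 * (t : ℝ)) * totalDefect b R L := by positivity
  have h4 : 0 ≤ D * (p + 1) * (R : ℝ) ^ (t + 1) := by positivity
  linarith

end Blocks

section Metric

variable {p : ℕ} [hp : Fact p.Prime]

/-! ### First moments of the defects -/

theorem card_ker_windowHom (q : (ZMod p)[X]) (s m : ℕ) (L : fracSeries p) :
    Nat.card (windowHom q s m L).ker =
      ∑ h : degreeLT (ZMod p) s, if coeffWindow (q * (h : (ZMod p)[X])) 0 m L = 0 then 1 else 0 := by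
  rw [← Finset.card_filter, Nat.subtype_card]
  intro h
  simp [AddMonoidHom.mem_ker, windowHom]

theorem measurable_card_ker (q : (ZMod p)[X]) (s m : ℕ) :
    Measurable fun L : fracSeries p => Nat.card (windowHom q s m L).ker := by
  simp_rw [card_ker_windowHom]
  exact Finset.measurable_sum _ fun h _ =>
    Measurable.ite (measurableSet_coeffWindow _ 0 m {0}) measurable_const measurable_const

/-- Linearity of expectation over h: h = 0 always lies in the kernel, while for h ≠ 0 the polynomial
q h is nonzero and its window vanishes with probability p^(-m). -/
theorem lintegral_card_ker_le {q : (ZMod p)[X]} (hq : q ≠ 0) (s m : ℕ) :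
    ∫⁻ L, (Nat.card (windowHom q s m L).ker : ENNReal) ∂haar p ≤
      1 + (p : ENNReal) ^ s * ((p : ENNReal) ^ m)⁻¹ := by
  classical
  have h1 : ∀ L : fracSeries p, (Nat.card (windowHom q s m L).ker : ENNReal) =
      ∑ h : degreeLT (ZMod p) s, (coeffWindow (q * (h : (ZMod p)[X])) 0 m ⁻¹' {0}).indicator 1 L := by
    intro L
    rw [card_ker_windowHom]
    push_cast
    refine Finset.sum_congr rfl fun h _ => ?_
    rw [Set.indicator_apply]
    exact if_congr Iff.rfl rfl rfl
  simp_rw [h1]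
  rw [lintegral_finsetSum _ fun h _ =>
    measurable_one.indicator (measurableSet_coeffWindow _ 0 m {0})]
  have h2 : ∀ h : degreeLT (ZMod p) s,
      ∫⁻ L, (coeffWindow (q * (h : (ZMod p)[X])) 0 m ⁻¹' {0}).indicator 1 L ∂haar p ≤
        (if h = 0 then 1 else 0) + ((p : ENNReal) ^ m)⁻¹ := by
    intro h
    rw [lintegral_indicator_one (measurableSet_coeffWindow _ 0 m {0})]
    split_ifs with h0
    · exact prob_le_one.trans le_self_add
    · rw [zero_add, haar_coeffWindow (mul_ne_zero hq fun h' => h0 (Subtype.ext h'))]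
  refine (Finset.sum_le_sum fun h _ => h2 h).trans (le_of_eq ?_)
  rw [Finset.sum_add_distrib, Finset.sum_ite_eq' Finset.univ (0 : degreeLT (ZMod p) s),
    if_pos (Finset.mem_univ _), Finset.sum_const, Finset.card_univ, card_degreeLT, nsmul_eq_mul]
  push_cast
  rfl

/-- The excess of the size of the kernel of `windowHom` over its generic value. -/
noncomputable def excess (q : (ZMod p)[X]) (s m : ℕ) (L : fracSeries p) : ℕ :=
  Nat.card (windowHom q s m L).ker - p ^ (s - m)

theorem measurable_excess (q : (ZMod p)[X]) (s m : ℕ) :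
    Measurable fun L : fracSeries p => (excess q s m L : ENNReal) :=
  (measurable_of_countable fun n : ℕ => ((n - p ^ (s - m) : ℕ) : ENNReal)).comp
    (measurable_card_ker q s m)

theorem card_ker_mul_card_range_windowHom (q : (ZMod p)[X]) {s m : ℕ} (hm : m ≤ s)
    (L : fracSeries p) :
    Nat.card (windowHom q s m L).ker * Nat.card (windowHom q s m L).range =
      p ^ (s - m) * p ^ m := by
  rw [card_ker_mul_card_range, card_degreeLT, ← pow_add, Nat.sub_add_cancel hm]

theorem card_range_windowHom_dvd (q : (ZMod p)[X]) (s m : ℕ) (L : fracSeries p) :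
    Nat.card (windowHom q s m L).range ∣ p ^ m := by
  have h := AddSubgroup.card_addSubgroup_dvd_card (windowHom q s m L).range
  rwa [Nat.card_eq_fintype_card (α := Fin m → ZMod p), Fintype.card_fun, ZMod.card,
    Fintype.card_fin] at h

theorem pow_le_card_ker (q : (ZMod p)[X]) {s m : ℕ} (hm : m ≤ s) (L : fracSeries p) :
    p ^ (s - m) ≤ Nat.card (windowHom q s m L).ker := by
  have h1 := card_ker_mul_card_range_windowHom q hm L
  have h2 := Nat.le_of_dvd (pow_pos hp.out.pos m) (card_range_windowHom_dvd q s m L)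
  refine Nat.le_of_mul_le_mul_right ?_ (pow_pos hp.out.pos m)
  rw [← h1]
  exact Nat.mul_le_mul_left _ h2

/-- A proper subgroup of F_p^m has index at least 2, and kernel size times image size is p^s. -/
theorem two_mul_pow_le_card_ker (q : (ZMod p)[X]) {s m : ℕ} (hm : m ≤ s) (L : fracSeries p)
    (hs : ¬ Function.Surjective (windowHom q s m L)) :
    2 * p ^ (s - m) ≤ Nat.card (windowHom q s m L).ker := by
  have hpm := pow_pos hp.out.pos m
  have h1 := card_ker_mul_card_range_windowHom q hm L
  obtain ⟨k, hk⟩ := card_range_windowHom_dvd q s m L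
  have hk1 : k ≠ 1 := by
    rintro rfl
    rw [mul_one] at hk
    refine hs (AddMonoidHom.range_eq_top.1 (AddSubgroup.eq_top_of_card_eq _ ?_))
    rw [← hk, Nat.card_eq_fintype_card, Fintype.card_fun, ZMod.card, Fintype.card_fin]
  have hk0 : k ≠ 0 := by
    rintro rfl
    rw [mul_zero] at hk
    omega
  have h2 : 2 * Nat.card (windowHom q s m L).range ≤ p ^ m := by
    rw [hk, mul_comm]
    exact Nat.mul_le_mul_left _ (by omega)
  refine Nat.le_of_mul_le_mul_right ?_ hpm
  rw [mul_assoc, ← h1]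
  calc _ = Nat.card (windowHom q s m L).ker * (2 * Nat.card (windowHom q s m L).range) := by ring
    _ ≤ _ := Nat.mul_le_mul_left _ h2

theorem defect_le_two_mul_excess (q : (ZMod p)[X]) {s m : ℕ} (hm : m ≤ s) (L : fracSeries p) :
    defect q s m L ≤ 2 * excess q s m L := by
  by_cases hs : Function.Surjective (windowHom q s m L)
  · rw [defect, if_pos hs]; exact Nat.zero_le _
  · rw [defect, if_neg hs, excess]
    have := two_mul_pow_le_card_ker q hm L hs
    omega

theorem pow_le_excess (q : (ZMod p)[X]) {s m : ℕ} (hm : m ≤ s) (L : fracSeries p)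
    (hd : defect q s m L ≠ 0) : p ^ (s - m) ≤ excess q s m L := by
  have hs : ¬ Function.Surjective (windowHom q s m L) := fun hs => hd (by rw [defect, if_pos hs])
  have := two_mul_pow_le_card_ker q hm L hs
  rw [excess]
  omega

/-- The generic size p^(s-m) cancels from the mean of the kernel size, leaving only the contribution
of h = 0. The bound is thus uniform in q, s and m. -/
theorem lintegral_excess_le {q : (ZMod p)[X]} (hq : q ≠ 0) {s m : ℕ} (hm : m ≤ s) :
    ∫⁻ L, (excess q s m L : ENNReal) ∂haar p ≤ 1 := by
  have hp0 : (p : ENNReal) ≠ 0 := Nat.cast_ne_zero.2 hp.out.ne_zero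
  have hpt : (p : ENNReal) ≠ ⊤ := ENNReal.natCast_ne_top p
  have h1 := lintegral_card_ker_le hq s m
  have h2 : ∀ L, (Nat.card (windowHom q s m L).ker : ENNReal) =
      excess q s m L + (p : ENNReal) ^ (s - m) := by
    intro L
    have := Nat.sub_add_cancel (pow_le_card_ker q hm L)
    rw [excess]
    exact_mod_cast this.symm
  have h3 : (p : ENNReal) ^ s * ((p : ENNReal) ^ m)⁻¹ = (p : ENNReal) ^ (s - m) := by
    conv_lhs => rw [← Nat.sub_add_cancel hm, pow_add]
    rw [mul_assoc, ENNReal.mul_inv_cancel (pow_ne_zero _ hp0) (ENNReal.pow_ne_top hpt), mul_one]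
  simp_rw [h2] at h1
  rw [h3, lintegral_add_right _ measurable_const, lintegral_const, measure_univ, mul_one] at h1
  exact (ENNReal.add_le_add_iff_right (ENNReal.pow_ne_top hpt)).1 h1

/-- Markov's inequality: a nonzero defect forces an excess of at least p^(s-m) ≥ 2^A, while the mean
is at most 1. -/
theorem haar_defect_ne_zero_le {q : (ZMod p)[X]} (hq : q ≠ 0) {s m A : ℕ} (hm : m + A ≤ s) :
    haar p {L | defect q s m L ≠ 0} ≤ ((2 : ENNReal) ^ A)⁻¹ := by
  have hms : m ≤ s := by omega
  have hsub : {L | defect q s m L ≠ 0} ⊆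
      {L : fracSeries p | ((2 : ENNReal) ^ A) ≤ (excess q s m L : ENNReal)} := by
    intro L hL
    have h1 : 2 ^ A ≤ p ^ (s - m) :=
      (Nat.pow_le_pow_left hp.out.two_le A).trans (Nat.pow_le_pow_right hp.out.pos (by omega))
    have h2 := h1.trans (pow_le_excess q hms L hL)
    show ((2 : ENNReal) ^ A) ≤ (excess q s m L : ENNReal)
    exact_mod_cast h2
  refine (measure_mono hsub).trans ?_
  have h3 := mul_meas_ge_le_lintegral (μ := haar p) (measurable_excess q s m) ((2 : ENNReal) ^ A)
  have h4 := h3.trans (lintegral_excess_le hq hms)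
  rw [← one_div, ENNReal.le_div_iff_mul_le (by simp) (by simp), mul_comm]
  exact h4

/-! ### Almost sure bound for the total defect -/

theorem natDegree_sub_lt {R r d m : ℕ} (hr : r < R) (hm : m ∈ Finset.range (r - d + 1)) :
    m < R := by
  have := Finset.mem_range.1 hm
  omega

variable {t : ℕ} (b : Fin t → (ZMod p)[X])

/-- The sum of the excesses close to the critical index. -/
noncomputable def nearExcess (R A : ℕ) (L : fracSeries p) : ℕ :=
  ∑ r ∈ Finset.range R, ∑ κ ∈ Fintype.piFinset fun _ : Fin t => Finset.range R,
    ∑ m ∈ (Finset.range (r - (∏ j, b j ^ κ j).natDegree + 1)).filter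
      fun m => r - (∏ j, b j ^ κ j).natDegree < m + A,
      excess (∏ j, b j ^ κ j) (r - (∏ j, b j ^ κ j).natDegree) m L

/-- The event that there is a defect far from the critical index. -/
def farEvent (R A : ℕ) : Set (fracSeries p) :=
  ⋃ r ∈ Finset.range R, ⋃ κ ∈ Fintype.piFinset fun _ : Fin t => Finset.range R,
    ⋃ m ∈ (Finset.range R).filter fun m => m + A ≤ r - (∏ j, b j ^ κ j).natDegree,
      {L | defect (∏ j, b j ^ κ j) (r - (∏ j, b j ^ κ j).natDegree) m L ≠ 0}

theorem totalDefect_le_of_notMem {R A : ℕ} {L : fracSeries p} (hL : L ∉ farEvent b R A) :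
    totalDefect b R L ≤ 2 * nearExcess b R A L := by
  rw [totalDefect, nearExcess, Finset.mul_sum]
  refine Finset.sum_le_sum fun r hr => ?_
  rw [Finset.mul_sum]
  refine Finset.sum_le_sum fun κ hκ => ?_
  rw [classDefect]
  split_ifs with hdeg
  · rw [Finset.mul_sum, ← Finset.sum_filter_add_sum_filter_not _
      (fun m => r - (∏ j, b j ^ κ j).natDegree < m + A)]
    have hzero : ∑ m ∈ (Finset.range (r - (∏ j, b j ^ κ j).natDegree + 1)).filter
        (fun m => ¬ r - (∏ j, b j ^ κ j).natDegree < m + A),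
        defect (∏ j, b j ^ κ j) (r - (∏ j, b j ^ κ j).natDegree) m L = 0 := by
      refine Finset.sum_eq_zero fun m hm => ?_
      rw [Finset.mem_filter, not_lt] at hm
      by_contra hne
      refine hL ?_
      simp only [farEvent, Set.mem_iUnion]
      refine ⟨r, hr, κ, hκ, m, ?_, hne⟩
      exact Finset.mem_filter.2
        ⟨Finset.mem_range.2 (natDegree_sub_lt (Finset.mem_range.1 hr) hm.1), hm.2⟩
    rw [hzero, add_zero]
    refine Finset.sum_le_sum fun m hm => defect_le_two_mul_excess _ ?_ L
    exact Nat.lt_succ_iff.1 (Finset.mem_range.1 (Finset.mem_filter.1 hm).1)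
  -- If deg B > r, the left side is 0; truncated subtraction puts only harmless terms with s = 0 on
  -- the right.
  · exact Nat.zero_le _

variable {b}

theorem prod_pow_ne_zero (hb : ∀ j, (b j).Monic) (κ : Fin t → ℕ) : ∏ j, b j ^ κ j ≠ 0 :=
  Finset.prod_ne_zero_iff.2 fun j _ => pow_ne_zero _ (hb j).ne_zero

theorem haar_farEvent_le (hb : ∀ j, (b j).Monic) (R A : ℕ) :
    haar p (farEvent b R A) ≤ (R : ENNReal) ^ (t + 2) * ((2 : ENNReal) ^ A)⁻¹ := by
  have h : haar p (farEvent b R A) ≤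
      ∑ _r ∈ Finset.range R, ∑ _κ ∈ Fintype.piFinset fun _ : Fin t => Finset.range R,
        (R : ENNReal) * ((2 : ENNReal) ^ A)⁻¹ := by
    refine (measure_biUnion_finset_le _ _).trans (Finset.sum_le_sum fun r _ => ?_)
    refine (measure_biUnion_finset_le _ _).trans (Finset.sum_le_sum fun κ _ => ?_)
    refine (measure_biUnion_finset_le _ _).trans ?_
    refine (Finset.sum_le_card_nsmul _ _ ((2 : ENNReal) ^ A)⁻¹ fun m hm => ?_).trans ?_
    · exact haar_defect_ne_zero_le (prod_pow_ne_zero hb κ) (Finset.mem_filter.1 hm).2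
    · rw [nsmul_eq_mul]
      gcongr
      exact (Finset.card_filter_le _ _).trans (Finset.card_range R).le
  refine h.trans (le_of_eq ?_)
  rw [Finset.sum_const, Finset.sum_const, Fintype.card_piFinset]
  simp only [Finset.card_range, Finset.prod_const, Finset.card_univ, Fintype.card_fin,
    nsmul_eq_mul]
  push_cast
  ring

theorem measurable_nearExcess (R A : ℕ) :
    Measurable fun L : fracSeries p => (nearExcess b R A L : ENNReal) := by
  simp only [nearExcess, Nat.cast_sum]
  exact Finset.measurable_sum _ fun r _ => Finset.measurable_sum _ fun κ _ =>
    Finset.measurable_sum _ fun m _ => measurable_excess _ _ _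

/-- There are R^(t+1) pairs (r, κ), and at most A values of m in (s - A, s] for each. -/
theorem lintegral_nearExcess_le (hb : ∀ j, (b j).Monic) (R A : ℕ) :
    ∫⁻ L, (nearExcess b R A L : ENNReal) ∂haar p ≤ (R : ENNReal) ^ (t + 1) * A := by
  simp only [nearExcess, Nat.cast_sum]
  rw [lintegral_finsetSum _ fun r _ => Finset.measurable_sum _ fun κ _ =>
    Finset.measurable_sum _ fun m _ => measurable_excess _ _ _]
  have h : ∀ r ∈ Finset.range R, ∫⁻ L, ∑ κ ∈ Fintype.piFinset fun _ : Fin t => Finset.range R,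
      ∑ m ∈ (Finset.range (r - (∏ j, b j ^ κ j).natDegree + 1)).filter
        fun m => r - (∏ j, b j ^ κ j).natDegree < m + A,
      (excess (∏ j, b j ^ κ j) (r - (∏ j, b j ^ κ j).natDegree) m L : ENNReal) ∂haar p ≤
        ∑ _κ ∈ Fintype.piFinset fun _ : Fin t => Finset.range R, (A : ENNReal) := by
    intro r _
    rw [lintegral_finsetSum _ fun κ _ =>
      Finset.measurable_sum _ fun m _ => measurable_excess _ _ _]
    refine Finset.sum_le_sum fun κ _ => ?_
    rw [lintegral_finsetSum _ fun m _ => measurable_excess _ _ _]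
    refine (Finset.sum_le_card_nsmul _ _ 1 fun m hm => ?_).trans ?_
    · exact lintegral_excess_le (prod_pow_ne_zero hb κ)
        (Nat.lt_succ_iff.1 (Finset.mem_range.1 (Finset.mem_filter.1 hm).1))
    · rw [nsmul_eq_mul, mul_one]
      set s := r - (∏ j, b j ^ κ j).natDegree
      have hsub : ((Finset.range (s + 1)).filter fun m => s < m + A) ⊆
          Finset.Ico (s + 1 - A) (s + 1) := by
        intro m hm
        rw [Finset.mem_filter, Finset.mem_range] at hm
        rw [Finset.mem_Ico]
        omega
      have hcard := Finset.card_le_card hsub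
      rw [Nat.card_Ico] at hcard
      exact_mod_cast hcard.trans (by omega)
  refine (Finset.sum_le_sum h).trans (le_of_eq ?_)
  rw [Finset.sum_const, Finset.sum_const, Fintype.card_piFinset]
  simp only [Finset.card_range, Finset.prod_const, Finset.card_univ, Fintype.card_fin,
    nsmul_eq_mul]
  push_cast
  ring

theorem tsum_inv_sq_ne_top : ∑' i : ℕ, (((i + 1 : ℕ) : ENNReal) ^ 2)⁻¹ ≠ ⊤ := by
  have h1 : Summable fun i : ℕ => (((i + 1 : ℕ) : ℝ) ^ 2)⁻¹ :=
    (summable_nat_add_iff 1).2 (Real.summable_nat_pow_inv.2 one_lt_two)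
  have h2 := h1.tsum_ofReal_ne_top
  refine ne_of_eq_of_ne (tsum_congr fun i => ?_) h2
  rw [ENNReal.ofReal_inv_of_pos (by positivity), ENNReal.ofReal_pow (by positivity),
    ENNReal.ofReal_natCast]

/-- Far defects eventually disappear by Borel–Cantelli; near ones are controlled by a normalized
series with finite mean. Restricting to R = 2^i is what makes both sums converge at the cost of only
a power of i. -/
theorem ae_totalDefect_le (hb : ∀ j, (b j).Monic) :
    ∀ᵐ L : fracSeries p ∂haar p, ∃ i₀ : ℕ, ∃ K : ℝ, 0 ≤ K ∧ ∀ i ≥ i₀,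
      (totalDefect b (2 ^ i) L : ℝ) ≤ K * ((2 : ℝ) ^ i) ^ (t + 1) * ((i : ℝ) + 1) ^ 3 := by
  -- With R = 2^i and A = (t+3) i, the bound R^(t+2) 2^(-A) is exactly 2^(-i).
  have hfar : ∀ᵐ L : fracSeries p ∂haar p,
      ∀ᶠ i : ℕ in Filter.atTop, L ∉ farEvent b (2 ^ i) ((t + 3) * i) := by
    refine ae_eventually_notMem ?_
    refine ne_top_of_le_ne_top (b := ∑' i : ℕ, ((2 : ENNReal)⁻¹) ^ i) ?_
      (ENNReal.tsum_le_tsum fun i => ?_)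
    · rw [ENNReal.tsum_geometric]
      simp
    · refine (haar_farEvent_le hb _ _).trans (le_of_eq ?_)
      have h0 : (2 : ENNReal) ^ (i * (t + 2)) ≠ 0 := by simp
      have ht : (2 : ENNReal) ^ (i * (t + 2)) ≠ ⊤ := by simp
      have hA : (2 : ENNReal) ^ ((t + 3) * i) = 2 ^ (i * (t + 2)) * 2 ^ i := by
        rw [← pow_add]; congr 1; ring
      rw [hA, Nat.cast_pow, Nat.cast_ofNat, ← pow_mul, ENNReal.mul_inv (Or.inl h0) (Or.inl ht), ← mul_assoc,
        ENNReal.mul_inv_cancel h0 ht, one_mul, ENNReal.inv_pow]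
  let c : ℕ → ENNReal := fun i => ((2 : ENNReal) ^ i) ^ (t + 1) * ((i + 1 : ℕ) : ENNReal) ^ 3
  have hc0 : ∀ i, c i ≠ 0 := fun i =>
    mul_ne_zero (by simp) (pow_ne_zero _ (Nat.cast_ne_zero.2 (Nat.succ_ne_zero i)))
  have hct : ∀ i, c i ≠ ⊤ := fun i => ENNReal.mul_ne_top
    (ENNReal.pow_ne_top (ENNReal.pow_ne_top ENNReal.ofNat_ne_top))
    (ENNReal.pow_ne_top (ENNReal.natCast_ne_top _))
  have hmeas : ∀ i, Measurable fun L : fracSeries p =>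
      (nearExcess b (2 ^ i) ((t + 3) * i) L : ENNReal) * (c i)⁻¹ :=
    fun i => (measurable_nearExcess _ _).mul_const _
  -- The i-th term has mean at most (t+3) i / (i+1)^3 ≤ (t+3) / (i+1)^2; this dictates the cube in
  -- `c`.
  have hnear : ∀ᵐ L : fracSeries p ∂haar p,
      ∑' i, (nearExcess b (2 ^ i) ((t + 3) * i) L : ENNReal) * (c i)⁻¹ < ⊤ := by
    refine ae_lt_top (Measurable.tsum hmeas) ?_
    rw [lintegral_tsum fun i => (hmeas i).aemeasurable]
    refine ne_top_of_le_ne_top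
      (b := ∑' i : ℕ, ((t + 3 : ℕ) : ENNReal) * (((i + 1 : ℕ) : ENNReal) ^ 2)⁻¹) ?_
      (ENNReal.tsum_le_tsum fun i => ?_)
    · rw [ENNReal.tsum_mul_left]
      exact ENNReal.mul_ne_top (ENNReal.natCast_ne_top _) tsum_inv_sq_ne_top
    · rw [lintegral_mul_const _ (measurable_nearExcess _ _), ← div_eq_mul_inv,
        ENNReal.div_le_iff (hc0 i) (hct i)]
      refine (lintegral_nearExcess_le hb _ _).trans ?_
      have h0 : ((i + 1 : ℕ) : ENNReal) ^ 2 ≠ 0 :=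
        pow_ne_zero _ (Nat.cast_ne_zero.2 (Nat.succ_ne_zero i))
      have ht : ((i + 1 : ℕ) : ENNReal) ^ 2 ≠ ⊤ := ENNReal.pow_ne_top (ENNReal.natCast_ne_top _)
      have h1 : ((t + 3 : ℕ) : ENNReal) * (((i + 1 : ℕ) : ENNReal) ^ 2)⁻¹ * c i =
          ((2 : ENNReal) ^ i) ^ (t + 1) * (((t + 3) * (i + 1) : ℕ) : ENNReal) := by
        simp only [c]
        rw [pow_succ ((i + 1 : ℕ) : ENNReal) 2, Nat.cast_mul]
        calc _ = ((2 : ENNReal) ^ i) ^ (t + 1) * (((t + 3 : ℕ) : ENNReal) * ((i + 1 : ℕ) : ENNReal)) *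
              ((((i + 1 : ℕ) : ENNReal) ^ 2)⁻¹ * ((i + 1 : ℕ) : ENNReal) ^ 2) := by ring
          _ = _ := by rw [ENNReal.inv_mul_cancel h0 ht, mul_one]
      rw [h1, Nat.cast_pow, Nat.cast_ofNat]
      gcongr
      omega
  filter_upwards [hfar, hnear] with L hL1 hL2
  obtain ⟨i₀, hi₀⟩ := Filter.eventually_atTop.1 hL1
  set Y := ∑' i, (nearExcess b (2 ^ i) ((t + 3) * i) L : ENNReal) * (c i)⁻¹ with hY
  refine ⟨i₀, 2 * Y.toReal, by positivity, fun i hi => ?_⟩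
  have h1 : (nearExcess b (2 ^ i) ((t + 3) * i) L : ENNReal) ≤ Y * c i := by
    rw [← ENNReal.div_le_iff (hc0 i) (hct i), div_eq_mul_inv]
    exact ENNReal.le_tsum (f := fun i =>
      (nearExcess b (2 ^ i) ((t + 3) * i) L : ENNReal) * (c i)⁻¹) i
  have h2 := ENNReal.toReal_mono (ENNReal.mul_ne_top hL2.ne (hct i)) h1
  rw [ENNReal.toReal_natCast, ENNReal.toReal_mul] at h2
  have h3 : (c i).toReal = ((2 : ℝ) ^ i) ^ (t + 1) * ((i : ℝ) + 1) ^ 3 := by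
    simp only [c, ENNReal.toReal_mul, ENNReal.toReal_pow, ENNReal.toReal_natCast,
      ENNReal.toReal_ofNat]
    push_cast
    rfl
  have h4 : (totalDefect b (2 ^ i) L : ℝ) ≤
      2 * (nearExcess b (2 ^ i) ((t + 3) * i) L : ℝ) := by
    exact_mod_cast totalDefect_le_of_notMem b (hi₀ i hi)
  rw [h3] at h2
  calc _ ≤ _ := h4
    _ ≤ 2 * (Y.toReal * (((2 : ℝ) ^ i) ^ (t + 1) * ((i : ℝ) + 1) ^ 3)) := by gcongr
    _ = _ := by ring

end Metric

/-! ### From dyadic R to powers of log N -/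

theorem exists_cube_le_two_pow_rpow {ε : ℝ} (hε : 0 < ε) :
    ∃ M : ℝ, 0 ≤ M ∧ ∀ i : ℕ, ((i : ℝ) + 1) ^ 3 ≤ M * ((2 : ℝ) ^ i) ^ ε := by
  have hr : (1 : ℝ) < 2 ^ ε := Real.one_lt_rpow one_lt_two hε
  have h1 := (isLittleO_pow_const_const_pow_of_one_lt (R := ℝ) 3 hr).isBigO
  obtain ⟨c, hc⟩ := (Asymptotics.isBigO_nat_atTop_iff fun n hn =>
    absurd hn (pow_pos (zero_lt_one.trans hr) n).ne').1 h1
  refine ⟨|c| * 2 ^ ε, by positivity, fun i => ?_⟩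
  have h2 := hc (i + 1)
  have h3 : ((2 : ℝ) ^ i) ^ ε = ((2 : ℝ) ^ ε) ^ i := by
    rw [← Real.rpow_natCast, ← Real.rpow_natCast, ← Real.rpow_mul two_pos.le,
      ← Real.rpow_mul two_pos.le, mul_comm]
  rw [Real.norm_of_nonneg (by positivity), Real.norm_of_nonneg (by positivity)] at h2
  push_cast at h2
  refine h2.trans ?_
  rw [h3, pow_succ']
  calc _ ≤ |c| * (2 ^ ε * (2 ^ ε) ^ i) := by gcongr; exact le_abs_self c
    _ = _ := by ring

theorem log_add_one_le_mul_log {p : ℕ} (hp : 2 ≤ p) {N : ℕ} (hN : 2 ≤ N) :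
    ((Nat.log p N + 1 : ℕ) : ℝ) ≤ 2 / Real.log 2 * Real.log N := by
  have hl2 : 0 < Real.log 2 := Real.log_pos one_lt_two
  have h1 : ((2 : ℕ) : ℝ) ^ Nat.log p N ≤ N := by
    have h : 2 ^ Nat.log p N ≤ N :=
      (Nat.pow_le_pow_left hp _).trans (Nat.pow_log_le_self p (by omega))
    exact_mod_cast h
  have h2 : (Nat.log p N : ℝ) * Real.log 2 ≤ Real.log N := by
    rw [← Real.log_pow]
    exact Real.log_le_log (by positivity) (by exact_mod_cast h1)
  have h3 : Real.log 2 ≤ Real.log N := Real.log_le_log two_pos (by exact_mod_cast hN)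
  rw [div_mul_eq_mul_div, le_div_iff₀ hl2]
  push_cast
  linarith

end KroneckerHalton

theorem theorem4 (p : ℕ) [Fact p.Prime] (t : ℕ) (ht : 1 ≤ t)
    (b : Fin t → Polynomial (ZMod p))
    (hmonic : ∀ j, (b j).Monic) (hnonconst : ∀ j, 0 < (b j).natDegree)
    (hcoprime : Pairwise fun i j => IsCoprime (b i) (b j)) :
    ∀ᵐ L : KroneckerHalton.fracSeries p ∂(KroneckerHalton.haar p), ∀ ε : ℝ, 0 < ε → ∃ C : ℝ, ∀ N : ℕ, 2 ≤ N →
      (N : ℝ) * KroneckerHalton.discrepancy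
          (KroneckerHalton.kroneckerHalton (L : LaurentSeries (ZMod p)) b) N
        ≤ C * Real.log N ^ ((t : ℝ) + 1 + ε) ∧
      (N : ℝ) * KroneckerHalton.starDiscrepancy
          (KroneckerHalton.kroneckerHalton (L : LaurentSeries (ZMod p)) b) N
        ≤ C * Real.log N ^ ((t : ℝ) + 1 + ε) := by
  have hp := (Fact.out : p.Prime)
  obtain ⟨C, hC0, hC⟩ :=
    KroneckerHalton.discrepancies_kroneckerHalton_le hmonic hnonconst hcoprime
  filter_upwards [KroneckerHalton.ae_forall_exists_coeff_ne,
    KroneckerHalton.ae_totalDefect_le hmonic] with L hL1 hL2 ε hε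
  obtain ⟨i₀, K, hK0, hK⟩ := hL2
  obtain ⟨M, hM0, hM⟩ := KroneckerHalton.exists_cube_le_two_pow_rpow hε
  set θ : ℝ := (t : ℝ) + 1 + ε with hθ
  have hθ0 : 0 ≤ θ := by positivity
  refine ⟨C * (1 + K * M) * (2 ^ (i₀ + 1) * (2 / Real.log 2)) ^ θ, fun N hN => ?_⟩
  set R := Nat.log p N + 1 with hR
  have hlogR : (R : ℝ) ≤ 2 / Real.log 2 * Real.log N :=
    KroneckerHalton.log_add_one_le_mul_log hp.two_le hN
  have hbound : (R : ℝ) ^ (t + 1) + KroneckerHalton.totalDefect b R L ≤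
      (1 + K * M) * (2 ^ (i₀ + 1) * (2 / Real.log 2)) ^ θ * Real.log N ^ θ := by
    -- Adding i₀ puts i in the range of the almost sure bound for every N, while 2^i still exceeds R
    -- by at most the factor 2^(i₀+1), which goes into the constant.
    set i := i₀ + (Nat.log 2 R + 1) with hi
    have hRi : R ≤ 2 ^ i := (Nat.lt_pow_succ_log_self one_lt_two R).le.trans
      (Nat.pow_le_pow_right two_pos (by omega))
    have hiR : (2 : ℝ) ^ i ≤ 2 ^ (i₀ + 1) * R := by
      have h : 2 ^ i ≤ 2 ^ (i₀ + 1) * R := by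
        rw [hi, show i₀ + (Nat.log 2 R + 1) = i₀ + 1 + Nat.log 2 R by ring, pow_add]
        exact Nat.mul_le_mul_left _ (Nat.pow_log_le_self 2 (by omega))
      exact_mod_cast h
    have h1i : (1 : ℝ) ≤ (2 : ℝ) ^ i := one_le_pow₀ one_le_two
    have hpow : ((2 : ℝ) ^ i) ^ (t + 1) * ((2 : ℝ) ^ i) ^ ε = ((2 : ℝ) ^ i) ^ θ := by
      rw [← Real.rpow_natCast _ (t + 1), ← Real.rpow_add (by positivity), hθ]
      push_cast
      rfl
    have h1 : (R : ℝ) ^ (t + 1) ≤ ((2 : ℝ) ^ i) ^ θ := by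
      rw [← hpow]
      have h : (R : ℝ) ^ (t + 1) ≤ ((2 : ℝ) ^ i) ^ (t + 1) := by
        gcongr
        exact_mod_cast hRi
      exact h.trans (le_mul_of_one_le_right (by positivity) (Real.one_le_rpow h1i hε.le))
    have h2 : (KroneckerHalton.totalDefect b R L : ℝ) ≤ K * M * ((2 : ℝ) ^ i) ^ θ := by
      have h : (KroneckerHalton.totalDefect b R L : ℝ) ≤ KroneckerHalton.totalDefect b (2 ^ i) L := by
        exact_mod_cast KroneckerHalton.totalDefect_mono b L hRi
      refine h.trans ((hK i (by omega)).trans ?_)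
      rw [← hpow]
      calc _ ≤ K * ((2 : ℝ) ^ i) ^ (t + 1) * (M * ((2 : ℝ) ^ i) ^ ε) := by
            gcongr
            exact hM i
        _ = _ := by ring
    have h3 : ((2 : ℝ) ^ i) ^ θ ≤
        (2 ^ (i₀ + 1) * (2 / Real.log 2)) ^ θ * Real.log N ^ θ := by
      have hl2 : 0 < Real.log 2 := Real.log_pos one_lt_two
      rw [← Real.mul_rpow (by positivity) (Real.log_natCast_nonneg N)]
      refine Real.rpow_le_rpow (by positivity) (hiR.trans ?_) hθ0
      rw [mul_assoc]
      gcongr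
    calc _ ≤ (1 + K * M) * ((2 : ℝ) ^ i) ^ θ := by linarith
      _ ≤ (1 + K * M) * ((2 ^ (i₀ + 1) * (2 / Real.log 2)) ^ θ * Real.log N ^ θ) := by gcongr
      _ = _ := by ring
  have hfin : C * ((R : ℝ) ^ (t + 1) + KroneckerHalton.totalDefect b R L) ≤
      C * (1 + K * M) * (2 ^ (i₀ + 1) * (2 / Real.log 2)) ^ θ * Real.log N ^ θ := by
    refine (mul_le_mul_of_nonneg_left hbound hC0).trans (le_of_eq ?_)
    ring
  have hmain := hC L hL1 N R (by omega) (Nat.lt_pow_succ_log_self hp.one_lt N)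
  exact ⟨hmain.1.trans hfin, hmain.2.trans hfin⟩
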